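/- Let $n\ge 4$ and $3\le k\le n-1$ be integers, let $Q_n=[-\tfrac12,\tfrac12]^n$, and for a unit vector $u\in S^{n-1}\subset\mathbb{R}^n$ let $$\sigma(u)=\mathrm{Vol}_{n-1}(Q_n\cap u^\perp).$$ Let $u\in S^{n-1}$ be a $k$-diagonal direction, that is, a unit vector parallel to a main diagonal of a $k$-dimensional face of $Q_n$ (equivalently, a vector obtained from $\mathbf d_{n,k}=\tfrac1{\sqrt k}(1,\dots,1,0,\dots,0)$, with $k$ ones, by permuting coordinates and changing signs). Then $u$ is neither a local minimum point nor a local maximum point (even in the non-strict sense) of $\sigma$ on $S^{n-1}$; that is, the central section $Q_n\cap u^\perp$ does not have locally extremal $(n-1)$-dimensional volume among the central sections of $Q_n$. -/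

import Mathlib

open MeasureTheory
open scoped ENNReal

noncomputable section

namespace CubeSection

/-- The centred unit cube `Q_n = [-1/2, 1/2]^n` in Euclidean space. -/
def cube (n : ℕ) : Set (EuclideanSpace ℝ (Fin n)) :=
  {x | ∀ i, x i ∈ Set.Icc (-(1 / 2) : ℝ) (1 / 2)}

/-- The vertices of `Q_n`. -/
def cubeVertices (n : ℕ) : Set (EuclideanSpace ℝ (Fin n)) :=
  {x | ∀ i, x i = -(1 / 2) ∨ x i = 1 / 2}

/-- The central section function `σ(u) = Vol_{n-1} (Q_n ∩ u^⊥)`. The `(n-1)`-dimensional volume is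
the Hausdorff measure, normalised to agree with Lebesgue measure on `(n-1)`-dimensional Euclidean
space. -/
def centralSectionVolume {n : ℕ} (u : EuclideanSpace ℝ (Fin n)) : ℝ≥0∞ :=
  μHE[n - 1] (cube n ∩ {x | inner ℝ u x = 0})

/-- `u` is a `k`-diagonal direction: a unit vector parallel to a main diagonal of a `k`-dimensional
face of `Q_n`. Such a diagonal joins two vertices `p`, `q` of the cube that differ in exactly `k`
coordinates (the free coordinates of the face). -/
def IsDiagonalDirection {n : ℕ} (k : ℕ) (u : EuclideanSpace ℝ (Fin n)) : Prop :=
  ‖u‖ = 1 ∧ ∃ p ∈ cubeVertices n, ∃ q ∈ cubeVertices n,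
    (Finset.univ.filter fun i => p i ≠ q i).card = k ∧ ∃ c : ℝ, u = c • (q - p)

end CubeSection

end

/-! A `k`-diagonal `u` lies on two explicit curves in the sphere, and each curve excludes one kind
of extremum. Take a vector with `d + 1` coordinates `±1`, one coordinate `±b` and zeros elsewhere,
and normalise it. With `d + 1 = k - 1` it passes through `u` at `b = 1`; with `d + 1 = k` it passes
through `u` at `b = 0`, which needs a zero coordinate, hence `k ≤ n - 1`.

Projecting the section along the coordinate carrying `b` turns it into a slab of a cube, so for `b >
0` its volume is `sectionProfile d b = √(d + 1 + b²) / b * ∫_{-b/2}^{b/2} B_d`, where the B-spline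
`B_d = bspline d` is the density of a sum of `d + 1` independent uniform variables. The sign of its
derivative is that of `profileSlope d`, which vanishes at both `b = 0` and `b = 1`. The claim
becomes: the profile strictly decreases just after `b = 1` (no local minimum) and strictly increases
just after `b = 0` (no local maximum).

One further derivative at `1`, two at `0`, and the spline recurrence reduce this to bounds for
`B_m(1) / B_m(0)`, apart from a few low degrees treated by explicit formulas: an upper bound at `b =
1` (`bspline_one_lt`) and a lower bound at `b = 0` (`lt_bspline_one`). Both follow from bounds on
`B_m((r+1)/2) / B_m((r-1)/2)` for all admissible integers `r`, a family that the recurrence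
propagates from one degree to the next (`bspline_ratio_upper`, `bspline_ratio_lower`). -/

namespace CubeSection

open Set Filter Topology Module ProbabilityTheory

/-! ### Centred B-splines: regularity, support, symmetry, derivative. -/

/-- The centred cardinal B-spline of degree `d`, i.e. the density of the sum of `d + 1` independent
uniform random variables on `[-1/2, 1/2]`. -/
noncomputable def bspline : ℕ → ℝ → ℝ
  | 0 => (Ico (-(1 / 2) : ℝ) (1 / 2)).indicator fun _ => 1
  | d + 1 => fun x => ∫ t in (x - 1 / 2)..(x + 1 / 2), bspline d t

theorem bspline_zero (x : ℝ) :
    bspline 0 x = (Ico (-(1 / 2) : ℝ) (1 / 2)).indicator (fun _ => (1 : ℝ)) x := rfl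

theorem bspline_succ (d : ℕ) (x : ℝ) :
    bspline (d + 1) x = ∫ t in (x - 1 / 2)..(x + 1 / 2), bspline d t := rfl

theorem continuous_integral_window {f : ℝ → ℝ} (hf : ∀ a b, IntervalIntegrable f volume a b) :
    Continuous fun x => ∫ t in (x - 1 / 2)..(x + 1 / 2), f t := by
  have h : (fun x => ∫ t in (x - 1 / 2)..(x + 1 / 2), f t) =
      fun x => (∫ t in (0 : ℝ)..(x + 1 / 2), f t) - ∫ t in (0 : ℝ)..(x - 1 / 2), f t := by
    funext x
    rw [intervalIntegral.integral_interval_sub_left (hf _ _) (hf _ _)]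
  rw [h]
  have hc := intervalIntegral.continuous_primitive hf 0
  exact (hc.comp (by fun_prop)).sub (hc.comp (by fun_prop))

theorem intervalIntegrable_bspline (d : ℕ) (a b : ℝ) :
    IntervalIntegrable (bspline d) volume a b := by
  induction d generalizing a b with
  | zero =>
    have h : Integrable (bspline 0) volume :=
      (integrable_indicator_iff measurableSet_Ico).2 (by simp)
    exact h.intervalIntegrable
  | succ d ih => exact (continuous_integral_window ih).intervalIntegrable a b

theorem continuous_bspline_succ (d : ℕ) : Continuous (bspline (d + 1)) :=
  continuous_integral_window (intervalIntegrable_bspline d)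

theorem continuous_bspline {d : ℕ} (hd : 1 ≤ d) : Continuous (bspline d) := by
  obtain ⟨e, rfl⟩ := Nat.exists_eq_add_of_le' hd
  exact continuous_bspline_succ e

theorem measurable_bspline (d : ℕ) : Measurable (bspline d) := by
  cases d with
  | zero => exact measurable_const.indicator measurableSet_Ico
  | succ d => exact (continuous_bspline_succ d).measurable

theorem bspline_nonneg (d : ℕ) (x : ℝ) : 0 ≤ bspline d x := by
  induction d generalizing x with
  | zero => exact indicator_nonneg (fun _ _ => zero_le_one) x
  | succ d ih => exact intervalIntegral.integral_nonneg (by linarith) fun t _ => ih t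

theorem bspline_eq_zero {d : ℕ} {x : ℝ} (hx : ((d : ℝ) + 1) / 2 ≤ x) : bspline d x = 0 := by
  induction d generalizing x with
  | zero =>
    rw [bspline_zero, indicator_of_notMem]
    norm_num at hx ⊢
    intro _
    linarith
  | succ d ih =>
    push_cast at hx
    rw [bspline_succ, intervalIntegral.integral_zero_ae]
    refine .of_forall fun t ht => ih ?_
    rw [uIoc_of_le (by linarith)] at ht
    linarith [ht.1]

theorem bspline_succ_neg_of_ae {d : ℕ} (h : ∀ᵐ t, bspline d (-t) = bspline d t) (x : ℝ) :
    bspline (d + 1) (-x) = bspline (d + 1) x := by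
  have h1 := intervalIntegral.integral_comp_neg (a := x - 1 / 2) (b := x + 1 / 2) (bspline d)
  rw [bspline_succ, bspline_succ, show -x - 1 / 2 = -(x + 1 / 2) by ring,
    show -x + 1 / 2 = -(x - 1 / 2) by ring, ← h1]
  exact intervalIntegral.integral_congr_ae (h.mono fun t ht _ => ht)

theorem bspline_neg_ae (d : ℕ) : ∀ᵐ t, bspline d (-t) = bspline d t := by
  induction d with
  | zero =>
    have h : ∀ᵐ t : ℝ, t ≠ 1 / 2 ∧ t ≠ -(1 / 2) :=
      (Measure.ae_ne volume _).and (Measure.ae_ne volume _)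
    filter_upwards [h] with t ⟨h1, h2⟩
    simp only [bspline_zero, indicator_apply, mem_Ico]
    congr 1
    apply propext
    constructor
    · rintro ⟨h3, h4⟩
      exact ⟨by linarith, lt_of_le_of_ne (by linarith) h1⟩
    · rintro ⟨h3, h4⟩
      have := lt_of_le_of_ne h3 h2.symm
      exact ⟨by linarith, by linarith⟩
  | succ d ih => exact .of_forall (bspline_succ_neg_of_ae ih)

theorem bspline_succ_neg (d : ℕ) (x : ℝ) : bspline (d + 1) (-x) = bspline (d + 1) x :=
  bspline_succ_neg_of_ae (bspline_neg_ae d) x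

theorem bspline_neg {d : ℕ} (hd : 1 ≤ d) (x : ℝ) : bspline d (-x) = bspline d x := by
  obtain ⟨e, rfl⟩ := Nat.exists_eq_add_of_le' hd
  exact bspline_succ_neg e x

theorem bspline_one (x : ℝ) : bspline 1 x = max 0 (1 - |x|) := by
  rw [bspline_succ, intervalIntegral.integral_of_le (by linarith)]
  have h : (fun t => bspline 0 t) = (Ico (-(1 / 2) : ℝ) (1 / 2)).indicator fun _ => 1 := rfl
  rw [h, setIntegral_indicator measurableSet_Ico, setIntegral_const, smul_eq_mul, mul_one,
    measureReal_congr (Ioc_ae_eq_Icc.inter Ico_ae_eq_Icc), Icc_inter_Icc, Real.volume_real_Icc]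
  rcases abs_cases x with ⟨h1, h2⟩ | ⟨h1, h2⟩ <;> rw [h1]
  · rw [max_eq_left (by linarith : -(1 / 2) ≤ x - 1 / 2),
      min_eq_right (by linarith : 1 / 2 ≤ x + 1 / 2), max_comm]
    ring_nf
  · rw [max_eq_right (by linarith : x - 1 / 2 ≤ -(1 / 2)),
      min_eq_left (by linarith : x + 1 / 2 ≤ 1 / 2), max_comm]
    ring_nf

theorem hasDerivAt_bspline_succ {d : ℕ} {x : ℝ} (h1 : ContinuousAt (bspline d) (x + 1 / 2))
    (h2 : ContinuousAt (bspline d) (x - 1 / 2)) :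
    HasDerivAt (bspline (d + 1)) (bspline d (x + 1 / 2) - bspline d (x - 1 / 2)) x := by
  have h : bspline (d + 1) =
      fun x => (∫ t in (0 : ℝ)..(x + 1 / 2), bspline d t) - ∫ t in (0 : ℝ)..(x - 1 / 2),
        bspline d t := by
    funext x
    rw [intervalIntegral.integral_interval_sub_left (intervalIntegrable_bspline d _ _)
      (intervalIntegrable_bspline d _ _)]
    rfl
  rw [h]
  have hm : ∀ y, StronglyMeasurableAtFilter (bspline d) (𝓝 y) volume :=
    fun y => (measurable_bspline d).stronglyMeasurable.stronglyMeasurableAtFilter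
  have a1 := (intervalIntegral.integral_hasDerivAt_right
    (intervalIntegrable_bspline d 0 (x + 1 / 2)) (hm _) h1).comp_add_const x (1 / 2)
  have a2 := (intervalIntegral.integral_hasDerivAt_right
    (intervalIntegrable_bspline d 0 (x - 1 / 2)) (hm _) h2).comp_sub_const x (1 / 2)
  exact a1.sub a2

theorem hasDerivAt_bspline {d : ℕ} (hd : 1 ≤ d) (x : ℝ) :
    HasDerivAt (bspline (d + 1)) (bspline d (x + 1 / 2) - bspline d (x - 1 / 2)) x :=
  hasDerivAt_bspline_succ (continuous_bspline hd).continuousAt (continuous_bspline hd).continuousAt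

/-! ### The degree recurrence and positivity. -/

/-- The recurrence at `x` for the spline of degree `d + 1`. -/
def BsplineRec (d : ℕ) (x : ℝ) : Prop :=
  ((d : ℝ) + 1) * bspline (d + 1) x =
    (x + ((d : ℝ) + 2) / 2) * bspline d (x + 1 / 2) +
      (((d : ℝ) + 2) / 2 - x) * bspline d (x - 1 / 2)

theorem bsplineRec_zero (x : ℝ) : BsplineRec 0 x := by
  simp only [BsplineRec, zero_add, bspline_one, bspline_zero, indicator_apply, mem_Ico]
  rcases lt_or_ge x (-1) with h1 | h1
  · rw [if_neg (by intro h; linarith [h.1]), if_neg (by intro h; linarith [h.1]),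
      abs_of_nonpos (by linarith), max_eq_left (by linarith)]
    simp
  rcases lt_or_ge x 0 with h2 | h2
  · rw [if_pos ⟨by linarith, by linarith⟩, if_neg (by intro h; linarith [h.1]),
      abs_of_nonpos (by linarith), max_eq_right (by linarith)]
    push_cast
    ring
  rcases lt_or_ge x 1 with h3 | h3
  · rw [if_neg (by intro h; linarith [h.2]), if_pos ⟨by linarith, by linarith⟩,
      abs_of_nonneg (by linarith), max_eq_right (by linarith)]
    push_cast
    ring
  · rw [if_neg (by intro h; linarith [h.2]), if_neg (by intro h; linarith [h.2]),
      abs_of_nonneg (by linarith), max_eq_left (by linarith)]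
    simp

/-- The tent has corners, so only one-sided derivatives exist everywhere. The half-open interval in
`bspline 0` makes it right-continuous, which gives the derivative formula at every point, corners
included. -/
theorem hasDerivWithinAt_bspline_one (x : ℝ) :
    HasDerivWithinAt (bspline 1) (bspline 0 (x + 1 / 2) - bspline 0 (x - 1 / 2)) (Ici x) x := by
  have key : ∀ (a b c : ℝ), x < c → (∀ y ∈ Ico x c, bspline 1 y = a + b * y) →
      HasDerivWithinAt (bspline 1) b (Ici x) x := by
    intro a b c hc h
    have h0 : HasDerivWithinAt (fun y : ℝ => a + b * y) b (Ici x) x := by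
      simpa using (((hasDerivAt_id x).const_mul b).const_add a).hasDerivWithinAt
    refine h0.congr_of_eventuallyEq ?_ (h x ⟨le_rfl, hc⟩)
    filter_upwards [Ico_mem_nhdsGE hc] with y hy using h y hy
  simp only [bspline_zero, indicator_apply, mem_Ico]
  rcases lt_or_ge x (-1) with h1 | h1
  · rw [if_neg (by intro h; linarith [h.1]), if_neg (by intro h; linarith [h.1])]
    refine key 0 _ (-1) h1 fun y hy => ?_
    rw [bspline_one, abs_of_nonpos (by linarith [hy.2]), max_eq_left (by linarith [hy.2])]
    simp
  rcases lt_or_ge x 0 with h2 | h2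
  · rw [if_pos ⟨by linarith, by linarith⟩, if_neg (by intro h; linarith [h.1])]
    refine key 1 _ 0 h2 fun y hy => ?_
    rw [bspline_one, abs_of_nonpos (by linarith [hy.2]), max_eq_right (by linarith [hy.1])]
    ring
  rcases lt_or_ge x 1 with h3 | h3
  · rw [if_neg (by intro h; linarith [h.2]), if_pos ⟨by linarith, by linarith⟩]
    refine key 1 _ 1 h3 fun y hy => ?_
    rw [bspline_one, abs_of_nonneg (by linarith [hy.1]), max_eq_right (by linarith [hy.2])]
    ring
  · rw [if_neg (by intro h; linarith [h.2]), if_neg (by intro h; linarith [h.2])]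
    refine key 0 _ (x + 1) (by linarith) fun y hy => ?_
    rw [bspline_one, abs_of_nonneg (by linarith [hy.1]), max_eq_left (by linarith [hy.1])]
    simp

theorem hasDerivWithinAt_bspline (d : ℕ) (x : ℝ) :
    HasDerivWithinAt (bspline (d + 1)) (bspline d (x + 1 / 2) - bspline d (x - 1 / 2))
      (Ici x) x := by
  cases d with
  | zero => exact hasDerivWithinAt_bspline_one x
  | succ d => exact (hasDerivAt_bspline (Nat.le_add_left 1 d) x).hasDerivWithinAt

/-- The defect `f` of the recurrence has right derivative zero, by the recurrence one degree lower
at `y ± 1/2`, and it vanishes beyond the support; hence it is identically zero. -/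
theorem bsplineRec (d : ℕ) (x : ℝ) : BsplineRec d x := by
  induction d generalizing x with
  | zero => exact bsplineRec_zero x
  | succ d ih =>
    set f : ℝ → ℝ := fun x => (x + ((d : ℝ) + 3) / 2) * bspline (d + 1) (x + 1 / 2) +
      (((d : ℝ) + 3) / 2 - x) * bspline (d + 1) (x - 1 / 2) -
      ((d : ℝ) + 2) * bspline (d + 2) x with hf
    have hc1 := continuous_bspline_succ d
    have hc2 := continuous_bspline_succ (d + 1)
    have hfc : Continuous f := by
      have := hc1.comp (continuous_id.add continuous_const : Continuous fun x : ℝ => x + 1 / 2)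
      have := hc1.comp (continuous_id.sub continuous_const : Continuous fun x : ℝ => x - 1 / 2)
      simp only [Function.comp_def] at *
      fun_prop
    have hshift : ∀ (c y : ℝ), HasDerivWithinAt (fun z => bspline (d + 1) (z + c))
        (bspline d (y + c + 1 / 2) - bspline d (y + c - 1 / 2)) (Ici y) y := by
      intro c y
      have h1 := hasDerivWithinAt_bspline d (y + c)
      have h2 : HasDerivWithinAt (fun z : ℝ => z + c) 1 (Ici y) y :=
        ((hasDerivAt_id y).add_const c).hasDerivWithinAt
      have := h1.scomp y h2 (fun z hz => by simpa using hz)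
      simpa [Function.comp_def] using this
    have hder : ∀ y, HasDerivWithinAt f 0 (Ici y) y := by
      intro y
      have a1 := ((hasDerivAt_id y).add_const (((d : ℝ) + 3) / 2)).hasDerivWithinAt (s := Ici y)
      have a2 := ((hasDerivAt_id y).const_sub (((d : ℝ) + 3) / 2)).hasDerivWithinAt (s := Ici y)
      have a3 := hshift (1 / 2) y
      have a4 := hshift (-(1 / 2)) y
      have a5 := (hasDerivAt_bspline (Nat.le_add_left 1 d) y).hasDerivWithinAt (s := Ici y)
      have := ((a1.mul a3).add (a2.mul a4)).sub (a5.const_mul ((d : ℝ) + 2))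
      refine (this.congr_deriv ?_).congr_of_eventuallyEq (.of_forall fun z => ?_) ?_
      · have e1 := ih (y + 1 / 2)
        have e2 := ih (y - 1 / 2)
        simp only [BsplineRec] at e1 e2
        rw [show y + 1 / 2 - 1 / 2 = y by ring] at e1
        rw [show y - 1 / 2 + 1 / 2 = y by ring] at e2
        simp only [id, ← sub_eq_add_neg, show y + 1 / 2 - 1 / 2 = y by ring,
          show y - 1 / 2 + 1 / 2 = y by ring]
        linear_combination e2 - e1
      · simp [hf, sub_eq_add_neg]
      · simp [hf, sub_eq_add_neg]
    have hmax : ∃ b, x ≤ b ∧ ((d : ℝ) + 3) / 2 + 1 ≤ b :=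
      ⟨max x (((d : ℝ) + 3) / 2 + 1), le_max_left _ _, le_max_right _ _⟩
    obtain ⟨b, hb1, hb2⟩ := hmax
    have h0 : f b = 0 := by
      simp only [hf]
      rw [bspline_eq_zero (by push_cast; linarith), bspline_eq_zero (by push_cast; linarith),
        bspline_eq_zero (by push_cast; linarith)]
      ring
    have := constant_of_has_deriv_right_zero hfc.continuousOn
      (fun y _ => hder y) b (⟨hb1, le_rfl⟩ : b ∈ Icc x b)
    rw [h0] at this
    simp only [hf] at this
    simp only [BsplineRec]
    push_cast
    rw [show (d : ℝ) + 1 + 2 = d + 3 by ring]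
    linarith

theorem bspline_recurrence (d : ℕ) (x : ℝ) :
    ((d : ℝ) + 1) * bspline (d + 1) x =
      (x + ((d : ℝ) + 2) / 2) * bspline d (x + 1 / 2) +
        (((d : ℝ) + 2) / 2 - x) * bspline d (x - 1 / 2) :=
  bsplineRec d x

/-- Inside the support both recurrence coefficients are positive, and the point `x - 1/2`, reflected
if negative, lies inside the support one degree lower. -/
theorem bspline_pos {d : ℕ} (hd : 1 ≤ d) {x : ℝ} (h0 : 0 ≤ x) (h1 : x < ((d : ℝ) + 1) / 2) :
    0 < bspline d x := by
  induction d, hd using Nat.le_induction generalizing x with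
  | base =>
    rw [bspline_one, abs_of_nonneg h0]
    norm_num at h1
    exact lt_max_of_lt_right (by linarith)
  | succ d hd ih =>
    have hrec := bspline_recurrence d x
    have hd' : (1 : ℝ) ≤ d := by exact_mod_cast hd
    push_cast at h1
    have n1 := bspline_nonneg d (x + 1 / 2)
    have n2 := bspline_nonneg d (x - 1 / 2)
    have c1 : 0 < x + ((d : ℝ) + 2) / 2 := by linarith
    have c2 : 0 < ((d : ℝ) + 2) / 2 - x := by linarith
    have : 0 < ((d : ℝ) + 1) * bspline (d + 1) x := by
      rw [hrec]
      rcases le_or_gt (1 / 2) x with h | h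
      · have := mul_pos c2 (ih (x := x - 1 / 2) (by linarith) (by linarith))
        have := mul_nonneg c1.le n1
        linarith
      · rw [show x - 1 / 2 = -(1 / 2 - x) by ring, bspline_neg hd] at *
        have := mul_pos c2 (ih (x := 1 / 2 - x) (by linarith) (by linarith))
        have := mul_nonneg c1.le n1
        linarith
    exact pos_of_mul_pos_right this (by linarith)

/-! ### Upper bound for ratios of spline values. -/

/-- The propagation of the upper ratio bound through the spline recurrence, for three consecutive
values `A`, `B`, `C`. -/
theorem upper_ratio_step {N ρ A B C : ℝ} (h0 : 0 ≤ ρ) (hN : ρ ≤ N)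
    (h1 : ((N + ρ + 1) ^ 3 - (N + ρ + 1)) * C ≤ ((N - ρ - 1) ^ 3 - (N - ρ - 1)) * B)
    (h2 : ((N + ρ - 1) ^ 3 - (N + ρ - 1)) * B ≤ ((N - ρ + 1) ^ 3 - (N - ρ + 1)) * A) :
    ((N + ρ + 1) ^ 3 - (N + ρ + 1)) * ((N + ρ + 1) * C + (N - ρ - 1) * B) +
        8 * ρ * (2 * ρ ^ 2 + 1) * B ≤
      ((N - ρ + 1) ^ 3 - (N - ρ + 1)) * ((N + ρ - 1) * B + (N - ρ + 1) * A) := by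
  have e1 := mul_le_mul_of_nonneg_left h1 (by linarith : 0 ≤ N + ρ + 1)
  have e2 := mul_le_mul_of_nonneg_left h2 (by linarith : 0 ≤ N - ρ + 1)
  -- An exact identity: once `A` and `C` are eliminated, the coefficients of `B` differ by precisely
  -- `8ρ(2ρ² + 1)`. This surplus later supplies strictness.
  linear_combination e1 + e2

theorem bspline_recurrence_right (d : ℕ) (x : ℝ) :
    2 * ((d : ℝ) + 1) * bspline (d + 1) ((x + 1) / 2) =
      ((d : ℝ) + 2 + x + 1) * bspline d ((x + 2) / 2) +
        ((d : ℝ) + 2 - x - 1) * bspline d (x / 2) := by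
  have h := bspline_recurrence d ((x + 1) / 2)
  rw [show (x + 1) / 2 + 1 / 2 = (x + 2) / 2 by ring, show (x + 1) / 2 - 1 / 2 = x / 2 by ring] at h
  linear_combination 2 * h

theorem bspline_recurrence_left (d : ℕ) (x : ℝ) :
    2 * ((d : ℝ) + 1) * bspline (d + 1) ((x - 1) / 2) =
      ((d : ℝ) + 2 + x - 1) * bspline d (x / 2) +
        ((d : ℝ) + 2 - x + 1) * bspline d ((x - 2) / 2) := by
  have h := bspline_recurrence d ((x - 1) / 2)
  rw [show (x - 1) / 2 + 1 / 2 = x / 2 by ring, show (x - 1) / 2 - 1 / 2 = (x - 2) / 2 by ring] at h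
  linear_combination 2 * h

theorem cube_sub_self_nonneg (m : ℕ) : (0 : ℝ) ≤ (m : ℝ) ^ 3 - m := by
  rcases Nat.eq_zero_or_pos m with rfl | h
  · norm_num
  · have h1 : (1 : ℝ) ≤ m := by exact_mod_cast h
    have : (m : ℝ) ^ 3 - m = m * ((m - 1) * (m + 1)) := by ring
    rw [this]
    exact mul_nonneg (by linarith) (mul_nonneg (by linarith) (by linarith))

theorem cube_sub_self_nonneg_sub {d r : ℕ} (h : r ≤ d) :
    (0 : ℝ) ≤ ((d : ℝ) - r) ^ 3 - ((d : ℝ) - r) := by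
  have := cube_sub_self_nonneg (d - r)
  rwa [Nat.cast_sub h] at this

/-- Only `r = 1` is wanted, but the recurrence expresses the values at `(r ± 1)/2` through three
values one degree lower, so the bound at `r` calls on those at `r - 1` and `r + 1`. For `r = 0` it
is an equality by symmetry; past the support the left side is zero. -/
theorem bspline_ratio_upper {d : ℕ} (hd : 1 ≤ d) {r : ℕ} (hr : r ≤ d + 2) :
    (((d : ℝ) + 2 + r) ^ 3 - ((d : ℝ) + 2 + r)) * bspline d (((r : ℝ) + 1) / 2) ≤
      (((d : ℝ) + 2 - r) ^ 3 - ((d : ℝ) + 2 - r)) * bspline d (((r : ℝ) - 1) / 2) := by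
  have hP : ∀ e : ℕ, r ≤ e + 2 → (0 : ℝ) ≤ ((e : ℝ) + 2 - r) ^ 3 - ((e : ℝ) + 2 - r) := by
    intro e he
    have := cube_sub_self_nonneg_sub he
    push_cast at this
    exact this
  induction d, hd using Nat.le_induction generalizing r with
  | base =>
    rcases Nat.eq_zero_or_pos r with rfl | h
    · simp only [Nat.cast_zero, Nat.cast_one]
      rw [show ((0 : ℝ) - 1) / 2 = -((0 + 1) / 2) by ring, bspline_succ_neg]
      norm_num
    · have h1 : (1 : ℝ) ≤ r := by exact_mod_cast h
      rw [bspline_eq_zero (by push_cast; linarith), mul_zero]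
      exact mul_nonneg (hP 1 hr) (bspline_nonneg _ _)
  | succ d hd ih =>
    rcases Nat.eq_zero_or_pos r with rfl | h
    · simp only [Nat.cast_zero]
      rw [show ((0 : ℝ) - 1) / 2 = -((0 + 1) / 2) by ring, bspline_succ_neg]
      simp
    have h1 : (1 : ℝ) ≤ r := by exact_mod_cast h
    rcases Nat.lt_or_ge (d + 1) r with h2 | h2
    · have h2' : (d : ℝ) + 2 ≤ r := by exact_mod_cast h2
      rw [bspline_eq_zero (by push_cast; linarith), mul_zero]
      exact mul_nonneg (hP _ hr) (bspline_nonneg _ _)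
    have h2' : (r : ℝ) ≤ d + 1 := by exact_mod_cast h2
    have i1 := ih (r := r + 1) (by omega)
      (fun e he => by have := cube_sub_self_nonneg_sub he; push_cast at this ⊢; exact this)
    have i2 := ih (r := r - 1) (by omega)
      (fun e he => by have := cube_sub_self_nonneg_sub he; push_cast at this ⊢; exact this)
    rw [Nat.cast_sub h] at i2
    push_cast at i1 i2
    have key := upper_ratio_step (N := (d : ℝ) + 2) (ρ := r) (A := bspline d (((r : ℝ) - 2) / 2))
      (B := bspline d ((r : ℝ) / 2)) (C := bspline d (((r : ℝ) + 2) / 2)) (by linarith)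
      (by linarith)
      (by convert i1 using 3 <;> ring_nf) (by convert i2 using 3 <;> ring_nf)
    have e0 : 0 ≤ 8 * (r : ℝ) * (2 * (r : ℝ) ^ 2 + 1) * bspline d ((r : ℝ) / 2) :=
      mul_nonneg (by positivity) (bspline_nonneg _ _)
    rw [← bspline_recurrence_right, ← bspline_recurrence_left] at key
    have hd0 : (0 : ℝ) < 2 * ((d : ℝ) + 1) := by positivity
    refine le_of_mul_le_mul_left ?_ hd0
    push_cast
    rw [show (d : ℝ) + 1 + 2 + r = d + 2 + r + 1 by ring,
      show (d : ℝ) + 1 + 2 - r = d + 2 - r + 1 by ring]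
    linarith

/-- The ratio bound at the centre: `h_p(1) / h_p(0) < p (p - 1) / ((p + 2) (p + 3))`,
where `p = d + 1`. -/
theorem bspline_one_lt {d : ℕ} (hd : 1 ≤ d) :
    ((d : ℝ) + 3) * ((d : ℝ) + 4) * bspline d 1 < ((d : ℝ) + 1) * d * bspline d 0 := by
  obtain rfl | hd2 := hd.eq_or_lt
  · simp [bspline_one]
  obtain ⟨e, rfl⟩ := Nat.exists_eq_add_of_le' hd
  have he : 1 ≤ e := by omega
  have he' : (1 : ℝ) ≤ e := by exact_mod_cast he
  have i1 := bspline_ratio_upper he (r := 2) (by omega)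
  have i2 := bspline_ratio_upper he (r := 0) (by omega)
  push_cast at i1 i2
  have key := upper_ratio_step (N := (e : ℝ) + 2) (ρ := 1) (A := bspline e ((1 - 2) / 2))
      (B := bspline e (1 / 2)) (C := bspline e ((1 + 2) / 2)) (by linarith) (by linarith)
      (by convert i1 using 3 <;> ring_nf) (by convert i2 using 3 <;> ring_nf)
  -- The case `r = 1` of the general bound is the desired inequality without strictness; the surplus
  -- in the last induction step makes it strict.
  have e0 : 0 < 8 * (1 : ℝ) * (2 * (1 : ℝ) ^ 2 + 1) * bspline e (1 / 2) :=
    mul_pos (by positivity) (bspline_pos he (by norm_num) (by linarith))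
  rw [← bspline_recurrence_right, ← bspline_recurrence_left] at key
  have hd0 : (0 : ℝ) < 2 * ((e : ℝ) + 1) * ((e : ℝ) + 3) := by positivity
  norm_num at key
  push_cast
  refine lt_of_mul_lt_mul_left ?_ hd0.le
  ring_nf at key e0 ⊢
  linarith

/-! ### Lower bound for ratios of spline values. -/

/-- Written in `α = ρ - 1` and `β = X - 3ρ - 3`, the difference of the two sides has only
nonnegative coefficients. -/
theorem lower_ratio_poly {α β : ℝ} (hα : 0 ≤ α) (hβ : 0 ≤ β) {N ρ X : ℝ} (hρ : ρ = 1 + α)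
    (hX : X = 3 * ρ + 3 + β) (hN : N = (X + 7 / 2) / 2) :
    ((N + ρ - 2) * (X - 3 * ρ + 3) ^ 2 + (N - ρ) * (X + 3 * ρ - 3) ^ 2) *
        (X + 2 - 3 * ρ) ^ 2 * (X + 3 * ρ + 3) ^ 2 ≤
      ((N + ρ) * (X - 3 * ρ - 3) ^ 2 + (N - ρ - 2) * (X + 3 * ρ + 3) ^ 2) *
        (X + 2 + 3 * ρ) ^ 2 * (X - 3 * ρ + 3) ^ 2 := by
  subst hN hX hρ
  rw [← sub_nonneg]
  ring_nf
  positivity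

/-- The counterpart near the end of the range of `ρ`, where no lower bound on `C` is available and
its term is discarded. -/
theorem lower_ratio_poly_edge {x y w : ℝ} (hx : 0 ≤ x) (hy : 0 ≤ y) (hw : 0 ≤ w) (hyw : y + w = 5)
    {N ρ X : ℝ} (hX : X = 17 / 2 + x) (hρ : 3 * ρ = X + 2 - y) (hN : N = (X + 7 / 2) / 2) :
    ((N + ρ - 2) * (X - 3 * ρ + 3) ^ 2 + (N - ρ) * (X + 3 * ρ - 3) ^ 2) * (X + 2 - 3 * ρ) ^ 2 ≤
      (N - ρ - 2) * (X + 2 + 3 * ρ) ^ 2 * (X - 3 * ρ + 3) ^ 2 := by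
  -- The difference of the two sides, as a cubic in `x` whose coefficients are in Bernstein form:
  -- homogeneous of degree 5 in `y` and `w`, using `y + w = 5`, with positive coefficients.
  have pos : 0 ≤ (441 / 6250 * w ^ 5 + 63 / 50 * w ^ 4 * y + 3533 / 1250 * w ^ 3 * y ^ 2 +
        17993 / 3750 * w ^ 2 * y ^ 3 + 13141 / 3750 * w * y ^ 4 + 12683 / 18750 * y ^ 5) +
      (231 / 6250 * w ^ 5 + 731 / 1250 * w ^ 4 * y + 5851 / 3750 * w ^ 3 * y ^ 2 +
        2377 / 1250 * w ^ 2 * y ^ 3 + 4163 / 3750 * w * y ^ 4 + 1381 / 6250 * y ^ 5) * x +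
      (16 / 3125 * w ^ 5 + 146 / 1875 * w ^ 4 * y + 146 / 625 * w ^ 3 * y ^ 2 +
        178 / 625 * w ^ 2 * y ^ 3 + 58 / 375 * w * y ^ 4 + 96 / 3125 * y ^ 5) * x ^ 2 +
      (2 / 9375 * w ^ 5 + 2 / 625 * w ^ 4 * y + 4 / 375 * w ^ 3 * y ^ 2 +
        28 / 1875 * w ^ 2 * y ^ 3 + 6 / 625 * w * y ^ 4 + 22 / 9375 * y ^ 5) * x ^ 3 := by
    positivity
  obtain rfl : w = 5 - y := by linarith
  obtain rfl : ρ = (X + 2 - y) / 3 := by linarith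
  subst hN hX
  linear_combination pos

/-- The propagation of the lower ratio bound through the spline recurrence, for three consecutive
values `A`, `B`, `C`. -/
theorem lower_ratio_step {N ρ X A B C : ℝ} (hX : 17 / 2 ≤ X) (hN : N = (X + 7 / 2) / 2)
    (hρ : 1 ≤ ρ) (hρX : 3 * ρ ≤ X + 2) (hB : 0 ≤ B) (hC : 0 ≤ C)
    (h1 : 3 * ρ + 3 ≤ X → (X - 3 * ρ - 3) ^ 2 * B ≤ (X + 3 * ρ + 3) ^ 2 * C)
    (h2 : (X - 3 * ρ + 3) ^ 2 * A ≤ (X + 3 * ρ - 3) ^ 2 * B) :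
    (X + 2 - 3 * ρ) ^ 2 * ((N + ρ - 2) * B + (N - ρ) * A) ≤
      (X + 2 + 3 * ρ) ^ 2 * ((N + ρ) * C + (N - ρ - 2) * B) := by
  have hNρ : 0 ≤ N - ρ := by linarith
  have hNρ' : 0 ≤ N + ρ := by linarith
  have ha : 0 < (X - 3 * ρ + 3) ^ 2 := pow_pos (by linarith) 2
  have hb : 0 < (X + 3 * ρ + 3) ^ 2 := pow_pos (by linarith) 2
  rcases le_or_gt (3 * ρ + 3) X with h | h
  · have p := mul_le_mul_of_nonneg_left (lower_ratio_poly (α := ρ - 1) (β := X - 3 * ρ - 3)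
      (by linarith) (by linarith) (by ring) (by ring) hN) hB
    have e1 := mul_le_mul_of_nonneg_left (h1 h)
      (by positivity : 0 ≤ (N + ρ) * (X + 2 + 3 * ρ) ^ 2 * (X - 3 * ρ + 3) ^ 2)
    have e2 := mul_le_mul_of_nonneg_left h2
      (by positivity : 0 ≤ (N - ρ) * (X + 2 - 3 * ρ) ^ 2 * (X + 3 * ρ + 3) ^ 2)
    refine le_of_mul_le_mul_left ?_ (mul_pos ha hb)
    linear_combination p + e1 + e2
  · have p := mul_le_mul_of_nonneg_left (lower_ratio_poly_edge (ρ := ρ) (x := X - 17 / 2)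
      (y := X + 2 - 3 * ρ) (w := 3 * ρ + 3 - X) (by linarith) (by linarith) (by linarith)
      (by ring) (by ring) (by ring) hN) hB
    have e2 := mul_le_mul_of_nonneg_left h2
      (by positivity : 0 ≤ (N - ρ) * (X + 2 - 3 * ρ) ^ 2)
    have e1 : 0 ≤ (X - 3 * ρ + 3) ^ 2 * ((X + 2 + 3 * ρ) ^ 2 * ((N + ρ) * C)) := by
      positivity
    refine le_of_mul_le_mul_left ?_ ha
    linear_combination p + e1 + e2

theorem bspline_two_of_le {x : ℝ} (h0 : 0 ≤ x) (h1 : x ≤ 1 / 2) :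
    bspline 2 x = 3 / 4 - x ^ 2 := by
  have h := bspline_recurrence 1 x
  rw [bspline_one, bspline_one, abs_of_nonneg (by linarith : 0 ≤ x + 1 / 2),
    abs_of_nonpos (by linarith : x - 1 / 2 ≤ 0), max_eq_right (by linarith),
    max_eq_right (by linarith)] at h
  norm_num at h
  linarith

theorem bspline_two_of_ge {x : ℝ} (h0 : 1 / 2 ≤ x) (h1 : x ≤ 3 / 2) :
    bspline 2 x = (3 / 2 - x) ^ 2 / 2 := by
  have h := bspline_recurrence 1 x
  rw [bspline_one, bspline_one, abs_of_nonneg (by linarith : 0 ≤ x + 1 / 2),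
    abs_of_nonneg (by linarith : 0 ≤ x - 1 / 2), max_eq_left (by linarith),
    max_eq_right (by linarith)] at h
  norm_num at h
  linarith

theorem bspline_three_of_le {x : ℝ} (h0 : 0 ≤ x) (h1 : x ≤ 1 / 2) :
    bspline 3 x = 2 / 3 - x ^ 2 + x ^ 3 / 2 := by
  have h := bspline_recurrence 2 x
  rw [show x - 1 / 2 = -(1 / 2 - x) by ring, bspline_succ_neg,
    bspline_two_of_ge (by linarith) (by linarith),
    bspline_two_of_le (x := 1 / 2 - x) (by linarith) (by linarith)] at h
  norm_num at h
  linear_combination h / 3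

theorem bspline_three_of_ge {x : ℝ} (h0 : 1 ≤ x) (h1 : x ≤ 2) :
    bspline 3 x = (2 - x) ^ 3 / 6 := by
  have h := bspline_recurrence 2 x
  rw [bspline_two_of_ge (x := x - 1 / 2) (by linarith) (by linarith),
    bspline_eq_zero (x := x + 1 / 2) (by push_cast; linarith)] at h
  norm_num at h
  linear_combination h / 3

/-- Induction on the degree as for the upper bound. At `r = 1` the bound agrees with the one needed
in `lt_bspline_one` up to order `1/d`, both being `1 - 6/d + O(1/d²)`. The induction starts at
degree 3 because the inequality fails for `d = 2`, `r = 2`, where the right side vanishes. -/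
theorem bspline_ratio_lower {d : ℕ} (hd : 3 ≤ d) {r : ℕ} (hr : 3 * (r : ℝ) ≤ 2 * d + 5 / 2) :
    (2 * (d : ℝ) + 5 / 2 - 3 * r) ^ 2 * bspline d (((r : ℝ) - 1) / 2) ≤
      (2 * (d : ℝ) + 5 / 2 + 3 * r) ^ 2 * bspline d (((r : ℝ) + 1) / 2) := by
  induction d, hd using Nat.le_induction generalizing r with
  | base =>
    have h3 : r < 3 := by
      by_contra h
      have : (3 : ℝ) ≤ r := by exact_mod_cast not_lt.1 h
      norm_num at hr
      linarith
    interval_cases r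
    · rw [Nat.cast_zero, show ((0 : ℝ) - 1) / 2 = -((0 + 1) / 2) by ring, bspline_succ_neg]
      norm_num
    · rw [bspline_three_of_le (by norm_num) (by norm_num),
        bspline_three_of_ge (by norm_num) (by norm_num)]
      norm_num
    · rw [bspline_three_of_le (by norm_num) (by norm_num),
        bspline_three_of_ge (by norm_num) (by norm_num)]
      norm_num
  | succ d hd ih =>
    rcases Nat.eq_zero_or_pos r with rfl | h
    · rw [Nat.cast_zero, show ((0 : ℝ) - 1) / 2 = -((0 + 1) / 2) by ring, bspline_succ_neg]
      simp
    have h1 : (1 : ℝ) ≤ r := by exact_mod_cast h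
    have hd3 : (3 : ℝ) ≤ d := by exact_mod_cast hd
    have hr1 : ((r - 1 : ℕ) : ℝ) = (r : ℝ) - 1 := by rw [Nat.cast_sub h, Nat.cast_one]
    push_cast at hr
    have i2 := ih (r := r - 1) (by rw [hr1]; linarith)
    rw [hr1] at i2
    have key := lower_ratio_step (N := (d : ℝ) + 3) (X := 2 * (d : ℝ) + 5 / 2) (ρ := r)
      (A := bspline d (((r : ℝ) - 2) / 2))
      (B := bspline d ((r : ℝ) / 2)) (C := bspline d (((r : ℝ) + 2) / 2)) (by linarith)
      (by ring) h1 (by linarith) (bspline_nonneg _ _) (bspline_nonneg _ _)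
      (fun h' => by
        have i1 := ih (r := r + 1) (by push_cast; linarith)
        push_cast at i1
        convert i1 using 3 <;> ring_nf)
      (by convert i2 using 3 <;> ring_nf)
    have r1 := bspline_recurrence_right d r
    have r2 := bspline_recurrence_left d r
    rw [show (d : ℝ) + 3 + r - 2 = d + 2 + r - 1 by ring,
      show (d : ℝ) + 3 - r = d + 2 - r + 1 by ring, ← r2,
      show (d : ℝ) + 3 + r = d + 2 + r + 1 by ring,
      show (d : ℝ) + 2 - r + 1 - 2 = d + 2 - r - 1 by ring, ← r1] at key
    have hd0 : (0 : ℝ) < 2 * ((d : ℝ) + 1) := by positivity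
    refine le_of_mul_le_mul_left ?_ hd0
    push_cast
    linear_combination key

/-- The ratio bound at the centre: `p (p - 2) / (p ^ 2 + 4 p + 6) < h_p(1) / h_p(0)`,
where `p = d + 1`. -/
theorem lt_bspline_one {d : ℕ} (hd : 2 ≤ d) :
    ((d : ℝ) + 1) * (d - 1) * bspline d 0 <
      (((d : ℝ) + 1) ^ 2 + 4 * (d + 1) + 6) * bspline d 1 := by
  obtain rfl | hd3 := hd.eq_or_lt
  · rw [bspline_two_of_le le_rfl (by norm_num), bspline_two_of_ge (by norm_num) (by norm_num)]
    norm_num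
  have hd3' : (3 : ℝ) ≤ d := by exact_mod_cast hd3
  have h := bspline_ratio_lower hd3 (r := 1) (by push_cast; linarith)
  norm_num at h
  have hpos : 0 < bspline d 0 := bspline_pos (by omega) le_rfl (by linarith)
  have e1 := mul_le_mul_of_nonneg_left h
    (by positivity : 0 ≤ ((d : ℝ) + 1) ^ 2 + 4 * (d + 1) + 6)
  have e2 : 0 < ((((d : ℝ) + 1) ^ 2 + 4 * (d + 1) + 6) * (2 * d + 5 / 2 - 3) ^ 2 -
      (d + 1) * (d - 1) * (2 * d + 5 / 2 + 3) ^ 2) * bspline d 0 := by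
    refine mul_pos ?_ hpos
    -- Expanding around `d = 3` leaves a polynomial in `c ≥ 0` whose positivity is visible termwise.
    obtain ⟨c, hc⟩ : ∃ c : ℝ, (d : ℝ) = 3 + c := ⟨d - 3, by ring⟩
    have hc0 : 0 ≤ c := by linarith
    rw [hc]
    ring_nf
    positivity
  refine lt_of_mul_lt_mul_left ?_ (by positivity : 0 ≤ (2 * (d : ℝ) + 5 / 2 + 3) ^ 2)
  linarith

/-! ### Monotonicity of the section profile to the right of `b = 1` and `b = 0`. -/

/-- The base point needs only continuity, not a derivative. At each of `0` and `1` this is applied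
twice: to pass from the derivative of the slope to the slope, then from the slope to the profile. -/
theorem eventually_lt_of_deriv_pos {f f' : ℝ → ℝ} {c : ℝ} (hc : ContinuousAt f c)
    (h : ∀ᶠ x in 𝓝[>] c, HasDerivAt f (f' x) x ∧ 0 < f' x) : ∀ᶠ x in 𝓝[>] c, f c < f x := by
  obtain ⟨δ, hδ, hs⟩ := mem_nhdsGT_iff_exists_Ioo_subset.1 h
  filter_upwards [Ioo_mem_nhdsGT hδ] with x hx
  have hmono : StrictMonoOn f (Icc c x) := by
    refine strictMonoOn_of_deriv_pos (convex_Icc c x) (fun y hy => ?_) fun y hy => ?_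
    · rcases hy.1.eq_or_lt with rfl | hy1
      · exact hc.continuousWithinAt
      · exact (hs ⟨hy1, hy.2.trans_lt hx.2⟩).1.continuousAt.continuousWithinAt
    · rw [interior_Icc] at hy
      have := hs ⟨hy.1, hy.2.trans hx.2⟩
      rw [this.1.deriv]
      exact this.2
  exact hmono ⟨le_rfl, hx.1.le⟩ ⟨hx.1.le, le_rfl⟩ hx.1

/-- The mass that the spline of degree `d` gives to `[-b/2, b/2]`. -/
noncomputable def centralMass (d : ℕ) (b : ℝ) : ℝ := ∫ t in (-(b / 2))..(b / 2), bspline d t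

/-- The volume of the central section of the cube orthogonal to a vector with `d + 1` coordinates
equal to `1`, one coordinate equal to `b`, and all the others equal to zero. -/
noncomputable def sectionProfile (d : ℕ) (b : ℝ) : ℝ :=
  √((d : ℝ) + 1 + b ^ 2) / b * centralMass d b

/-- The numerator of the derivative of `sectionProfile`. -/
noncomputable def profileSlope (d : ℕ) (b : ℝ) : ℝ :=
  b * ((d : ℝ) + 1 + b ^ 2) * bspline d (b / 2) - ((d : ℝ) + 1) * centralMass d b

theorem hasDerivAt_centralMass {d : ℕ} (hd : 1 ≤ d) (b : ℝ) :
    HasDerivAt (centralMass d) (bspline d (b / 2)) b := by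
  have h : centralMass d = fun b => (∫ t in (0 : ℝ)..(b / 2), bspline d t) -
      ∫ t in (0 : ℝ)..(-(b / 2)), bspline d t := by
    funext x
    rw [intervalIntegral.integral_interval_sub_left (intervalIntegrable_bspline d _ _)
      (intervalIntegrable_bspline d _ _)]
    rfl
  have hi : ∀ y, HasDerivAt (fun u => ∫ t in (0 : ℝ)..u, bspline d t) (bspline d y) y :=
    fun y => (continuous_bspline hd).integral_hasStrictDerivAt 0 y |>.hasDerivAt
  have e1 : HasDerivAt (fun y : ℝ => y / 2) (1 / 2) b := (hasDerivAt_id b).div_const 2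
  have a1 := (hi (b / 2)).comp b e1
  have a2 := (hi (-(b / 2))).comp b e1.neg
  rw [h]
  refine (a1.sub a2).congr_deriv ?_
  rw [bspline_neg hd]
  ring

theorem continuous_centralMass {d : ℕ} (hd : 1 ≤ d) : Continuous (centralMass d) :=
  continuous_iff_continuousAt.2 fun b => (hasDerivAt_centralMass hd b).continuousAt

theorem centralMass_one (d : ℕ) : centralMass d 1 = bspline (d + 1) 0 := by
  rw [centralMass, bspline_succ]
  norm_num

theorem centralMass_zero (d : ℕ) : centralMass d 0 = 0 := by simp [centralMass]

theorem sectionProfile_one (d : ℕ) :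
    sectionProfile d 1 = √((d : ℝ) + 2) * bspline (d + 1) 0 := by
  rw [sectionProfile, centralMass_one, div_one]
  congr 2
  ring

theorem hasDerivAt_sectionProfile {d : ℕ} (hd : 1 ≤ d) {b : ℝ} (hb : 0 < b) :
    HasDerivAt (sectionProfile d)
      (profileSlope d b / (b ^ 2 * √((d : ℝ) + 1 + b ^ 2))) b := by
  have hpos : 0 < (d : ℝ) + 1 + b ^ 2 := by positivity
  have hs : 0 < √((d : ℝ) + 1 + b ^ 2) := Real.sqrt_pos.2 hpos
  have hs2 : √((d : ℝ) + 1 + b ^ 2) ^ 2 = (d : ℝ) + 1 + b ^ 2 := Real.sq_sqrt hpos.le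
  have h1 : HasDerivAt (fun b : ℝ => (d : ℝ) + 1 + b ^ 2) (2 * b) b := by
    simpa using (hasDerivAt_pow 2 b).const_add ((d : ℝ) + 1)
  have h2 := ((h1.sqrt hpos.ne').div (hasDerivAt_id b) hb.ne').mul (hasDerivAt_centralMass hd b)
  refine h2.congr_deriv ?_
  simp only [id, profileSlope, Pi.div_apply]
  field_simp
  rw [hs2]
  ring

theorem hasDerivAt_profileSlope {d : ℕ} (hd : 1 ≤ d) {b D : ℝ}
    (hD : HasDerivAt (bspline d) D (b / 2)) :
    HasDerivAt (profileSlope d)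
      (3 * b ^ 2 * bspline d (b / 2) + b * ((d : ℝ) + 1 + b ^ 2) / 2 * D) b := by
  have e1 : HasDerivAt (fun y : ℝ => y / 2) (1 / 2) b := (hasDerivAt_id b).div_const 2
  have h1 : HasDerivAt (fun b : ℝ => (d : ℝ) + 1 + b ^ 2) (2 * b) b := by
    simpa using (hasDerivAt_pow 2 b).const_add ((d : ℝ) + 1)
  have h2 := (((hasDerivAt_id b).mul h1).mul (hD.comp b e1)).sub
    ((hasDerivAt_centralMass hd b).const_mul ((d : ℝ) + 1))
  refine (h2.congr_deriv ?_).congr_of_eventuallyEq (.of_forall fun x => ?_)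
  · simp
    ring
  · simp [profileSlope]

theorem continuous_profileSlope {d : ℕ} (hd : 1 ≤ d) : Continuous (profileSlope d) := by
  have h1 := continuous_bspline hd
  have h2 := continuous_centralMass hd
  unfold profileSlope
  fun_prop

/-- The critical point at `b = 1` is exactly the recurrence at `x = 0`. -/
theorem profileSlope_one {d : ℕ} (hd : 1 ≤ d) : profileSlope d 1 = 0 := by
  have h := bspline_recurrence d 0
  rw [show (0 : ℝ) - 1 / 2 = -(0 + 1 / 2) by ring, bspline_neg hd] at h
  simp only [zero_add] at h
  rw [profileSlope, centralMass_one]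
  linear_combination -h

theorem profileSlope_zero (d : ℕ) : profileSlope d 0 = 0 := by
  simp [profileSlope, centralMass_zero]

theorem hasDerivAt_bspline_one {x : ℝ} (h0 : 0 < x) (h1 : x < 1) :
    HasDerivAt (bspline 1) (-1) x := by
  refine ((hasDerivAt_id x).const_sub 1).congr_of_eventuallyEq ?_
  filter_upwards [Ioo_mem_nhds h0 h1] with y hy
  rw [bspline_one, abs_of_pos hy.1, max_eq_right (by linarith [hy.2])]
  rfl

/-- The derivative of `profileSlope d` at `b`. -/
noncomputable def profileCurvature (d : ℕ) (b : ℝ) : ℝ :=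
  3 * b * bspline d (b / 2) +
    ((d : ℝ) + 1 + b ^ 2) / 2 * (bspline (d - 1) ((b + 1) / 2) - bspline (d - 1) ((b - 1) / 2))

/-- The factor `b` is kept outside `profileCurvature`; it does not affect signs for `b > 0`, and
removing it lowers the order of vanishing at `0`. -/
theorem hasDerivAt_profileSlope_curvature {d : ℕ} (hd : 2 ≤ d) (b : ℝ) :
    HasDerivAt (profileSlope d) (b * profileCurvature d b) b := by
  obtain ⟨e, rfl⟩ := Nat.exists_eq_add_of_le' (show 1 ≤ d by omega)
  have h := hasDerivAt_profileSlope (by omega) (hasDerivAt_bspline (show 1 ≤ e by omega) (b / 2))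
  refine h.congr_deriv ?_
  rw [profileCurvature, Nat.add_sub_cancel, show (b + 1) / 2 = b / 2 + 1 / 2 by ring,
    show (b - 1) / 2 = b / 2 - 1 / 2 by ring]
  ring

theorem continuous_profileCurvature {d : ℕ} (hd : 2 ≤ d) : Continuous (profileCurvature d) := by
  have h1 := continuous_bspline (show 1 ≤ d by omega)
  have h2 := continuous_bspline (show 1 ≤ d - 1 by omega)
  unfold profileCurvature
  fun_prop

theorem profileCurvature_one_neg {d : ℕ} (hd : 2 ≤ d) : profileCurvature d 1 < 0 := by
  obtain ⟨e, rfl⟩ := Nat.exists_eq_add_of_le' (show 1 ≤ d by omega)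
  have h := bspline_one_lt (show 1 ≤ e by omega)
  have hrec := bspline_recurrence e (1 / 2)
  norm_num at hrec
  rw [profileCurvature, Nat.add_sub_cancel]
  norm_num
  have he : (0 : ℝ) < 2 * ((e : ℝ) + 1) := by positivity
  refine neg_of_mul_neg_right ?_ he.le
  -- With the recurrence at `1/2`, `2(e + 1)` times the curvature equals `(e + 3)(e + 4) B_e(1) - (e
  -- + 1) e B_e(0)`.
  linear_combination h + 6 * hrec

theorem eventually_sectionProfile_lt {d : ℕ} (hd : 1 ≤ d) :
    ∀ᶠ b in 𝓝[>] (1 : ℝ), sectionProfile d b < sectionProfile d 1 := by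
  have hslope : ∀ᶠ b in 𝓝[>] (1 : ℝ), profileSlope d b < 0 := by
    have h : ∃ D : ℝ → ℝ, ∀ᶠ b in 𝓝[>] (1 : ℝ), HasDerivAt (profileSlope d) (D b) b ∧ D b < 0 := by
      obtain rfl | hd2 := hd.eq_or_lt
      -- For `d = 1` the derivative of the slope is `-b (b - 1) (2b - 1)`, which vanishes at `b =
      -- 1`, so the second-order test is inconclusive and the sign is read off on `(1, 2)`.
      · refine ⟨fun b => 3 * b ^ 2 * bspline 1 (b / 2) +
          b * (((1 : ℕ) : ℝ) + 1 + b ^ 2) / 2 * -1, ?_⟩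
        filter_upwards [Ioo_mem_nhdsGT (show (1 : ℝ) < 2 by norm_num)] with b hb
        refine ⟨hasDerivAt_profileSlope le_rfl
          (hasDerivAt_bspline_one (by linarith [hb.1]) (by linarith [hb.2])), ?_⟩
        rw [bspline_one, abs_of_pos (by linarith [hb.1]), max_eq_right (by linarith [hb.2])]
        have : 0 < b * (b - 1) * (2 * b - 1) :=
          mul_pos (mul_pos (by linarith [hb.1]) (by linarith [hb.1])) (by linarith [hb.1])
        norm_num
        linarith
      · refine ⟨fun b => b * profileCurvature d b, ?_⟩
        have hc := (continuous_profileCurvature hd2).continuousAt.eventually_lt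
          (continuousAt_const (y := (0 : ℝ))) (profileCurvature_one_neg hd2)
        filter_upwards [nhdsWithin_le_nhds hc, self_mem_nhdsWithin] with b hb hb1
        exact ⟨hasDerivAt_profileSlope_curvature hd2 b,
          mul_neg_of_pos_of_neg (zero_lt_one.trans hb1) hb⟩
    obtain ⟨D, hD⟩ := h
    have := eventually_lt_of_deriv_pos (f := fun b => -profileSlope d b) (f' := fun b => -D b)
      (continuous_profileSlope hd).neg.continuousAt
      (hD.mono fun b hb => ⟨hb.1.neg, neg_pos.2 hb.2⟩)
    filter_upwards [this] with b hb
    rw [profileSlope_one hd] at hb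
    linarith
  have := eventually_lt_of_deriv_pos (f := fun b => -sectionProfile d b)
    (f' := fun b => -(profileSlope d b / (b ^ 2 * √((d : ℝ) + 1 + b ^ 2)))) (c := 1)
    (hasDerivAt_sectionProfile hd one_pos).neg.continuousAt
    (by
      filter_upwards [hslope, self_mem_nhdsWithin] with b hb hb1
      have hb0 : (0 : ℝ) < b := zero_lt_one.trans hb1
      refine ⟨(hasDerivAt_sectionProfile hd hb0).neg, neg_pos.2 (div_neg_of_neg_of_pos hb ?_)⟩
      positivity)
  filter_upwards [this] with b hb
  linarith

theorem eventually_profileCurvature_pos {d : ℕ} (hd : 2 ≤ d) :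
    ∀ᶠ b in 𝓝[>] (0 : ℝ), 0 < profileCurvature d b := by
  obtain ⟨e, rfl⟩ := Nat.exists_eq_add_of_le' (show 1 ≤ d by omega)
  have he : 1 ≤ e := by omega
  have hsymm : ∀ b : ℝ, bspline e ((b - 1) / 2) = bspline e ((1 - b) / 2) := fun b => by
    rw [← bspline_neg he]
    congr 1
    ring
  -- For `e ≥ 3` the curvature vanishes at `0` with positive derivative. For `e = 2` that derivative
  -- vanishes as well, and for `e = 1` the formula would involve the discontinuous `bspline 0`; both
  -- are computed explicitly.
  rcases (show e = 1 ∨ e = 2 ∨ 3 ≤ e by omega) with rfl | rfl | he3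
  · filter_upwards [Ioo_mem_nhdsGT (show (0 : ℝ) < 1 / 2 by norm_num)] with b hb
    rw [profileCurvature, Nat.add_sub_cancel, hsymm, bspline_one, bspline_one,
      bspline_two_of_le (by linarith [hb.1]) (by linarith [hb.2]),
      abs_of_pos (by linarith [hb.1]), abs_of_pos (by linarith [hb.2]),
      max_eq_right (by linarith [hb.2]), max_eq_right (by linarith [hb.1])]
    have : 0 < b * (3 / 4 - 5 / 4 * b ^ 2) := mul_pos hb.1 (by nlinarith [hb.1, hb.2])
    norm_num
    linarith
  · filter_upwards [Ioo_mem_nhdsGT (show (0 : ℝ) < 1 / 2 by norm_num)] with b hb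
    rw [profileCurvature, Nat.add_sub_cancel, hsymm,
      bspline_three_of_le (by linarith [hb.1]) (by linarith [hb.2]),
      bspline_two_of_ge (by linarith [hb.1]) (by linarith [hb.2]),
      bspline_two_of_le (by linarith [hb.2]) (by linarith [hb.1])]
    have : 0 < b ^ 2 * (3 / 4 - 5 / 4 * b + 3 / 8 * b ^ 2) :=
      mul_pos (pow_pos hb.1 2) (by nlinarith [hb.1, hb.2])
    norm_num
    linarith
  · obtain ⟨f, rfl⟩ := Nat.exists_eq_add_of_le' he
    have hf : 2 ≤ f := by omega
    set D := bspline f 1 - bspline f 0 with hDdef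
    have hD : HasDerivAt (bspline (f + 1)) D (1 / 2) := by
      have := hasDerivAt_bspline (show 1 ≤ f by omega) (1 / 2)
      norm_num at this
      exact this
    have hD1 : HasDerivAt (fun b : ℝ => bspline (f + 1) ((b + 1) / 2)) (D * (1 / 2)) 0 := by
      have e1 : HasDerivAt (fun b : ℝ => (b + 1) / 2) (1 / 2) 0 :=
        ((hasDerivAt_id 0).add_const 1).div_const 2
      exact HasDerivAt.comp (h₂ := bspline (f + 1)) 0 (by norm_num; norm_num at hD; exact hD) e1
    have hD2 : HasDerivAt (fun b : ℝ => bspline (f + 1) ((b - 1) / 2)) (D * (-1 / 2)) 0 := by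
      have e1 : HasDerivAt (fun b : ℝ => (1 - b) / 2) (-1 / 2) 0 :=
        ((hasDerivAt_id 0).const_sub 1).div_const 2
      refine (HasDerivAt.comp (h₂ := bspline (f + 1)) 0
        (by norm_num; norm_num at hD; exact hD) e1).congr_of_eventuallyEq (.of_forall hsymm)
    have e1 : HasDerivAt (fun y : ℝ => y / 2) (1 / 2) 0 := (hasDerivAt_id 0).div_const 2
    have h0 := (hasDerivAt_bspline (show 1 ≤ f + 1 by omega) ((0 : ℝ) / 2)).comp 0 e1
    have h1 : HasDerivAt (fun b : ℝ => (((f + 1 + 1 : ℕ) : ℝ) + 1 + b ^ 2) / 2) 0 0 := by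
      simpa using ((hasDerivAt_pow 2 (0 : ℝ)).const_add (((f + 1 + 1 : ℕ) : ℝ) + 1)).div_const 2
    have h2 := (((hasDerivAt_id (0 : ℝ)).const_mul 3).mul h0).add (h1.mul (hD1.sub hD2))
    have hpos : 0 < 3 * bspline (f + 2) 0 + ((f : ℝ) + 3) / 2 * D := by
      have h := lt_bspline_one hf
      have hrec1 := bspline_recurrence f (1 / 2)
      have hrec2 := bspline_recurrence (f + 1) 0
      rw [show (0 : ℝ) - 1 / 2 = -(0 + 1 / 2) by ring, bspline_neg he] at hrec2
      simp only [zero_add] at hrec2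
      norm_num at hrec1
      push_cast at hrec2
      have hc : (0 : ℝ) < 2 * (((f : ℝ) + 1) * ((f : ℝ) + 2)) := by positivity
      have hc3 : (0 : ℝ) < (f : ℝ) + 3 := by positivity
      have h' := mul_lt_mul_of_pos_left h hc3
      refine pos_of_mul_pos_right ?_ hc.le
      rw [hDdef]
      -- The recurrence at `0` and at `1/2` turns the claim, multiplied by `2(f + 1)(f + 2)`, into
      -- `f + 3` times `lt_bspline_one`.
      linear_combination h' - 6 * ((f : ℝ) + 1) * hrec2 - 6 * ((f : ℝ) + 3) * hrec1
    have hcurv0 : profileCurvature (f + 1 + 1) 0 = 0 := by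
      rw [profileCurvature, Nat.add_sub_cancel, hsymm]
      norm_num
    have hderiv : HasDerivAt (profileCurvature (f + 1 + 1))
        (3 * bspline (f + 2) 0 + ((f : ℝ) + 3) / 2 * D) 0 := by
      refine (h2.congr_deriv ?_).congr_of_eventuallyEq (.of_forall fun x => ?_)
      · simp
        ring
      · simp [profileCurvature]
    have hs := (hasDerivAt_iff_tendsto_slope.1 hderiv).eventually_const_lt hpos
    filter_upwards [nhdsGT_le_nhdsNE 0 hs, self_mem_nhdsWithin] with b hb hb0
    rw [slope_def_field, hcurv0, sub_zero, sub_zero] at hb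
    exact (div_pos_iff_of_pos_right hb0).1 hb

theorem tendsto_sectionProfile_zero {d : ℕ} (hd : 1 ≤ d) :
    Tendsto (sectionProfile d) (𝓝[≠] 0) (𝓝 (√((d : ℝ) + 1) * bspline d 0)) := by
  have h1 := hasDerivAt_iff_tendsto_slope.1 (hasDerivAt_centralMass hd 0)
  have h2 : Tendsto (fun b : ℝ => √((d : ℝ) + 1 + b ^ 2)) (𝓝[≠] 0) (𝓝 √((d : ℝ) + 1)) := by
    have : Continuous fun b : ℝ => √((d : ℝ) + 1 + b ^ 2) := by fun_prop
    simpa using (this.tendsto 0).mono_left nhdsWithin_le_nhds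
  rw [zero_div] at h1
  refine (h2.mul h1).congr fun b => ?_
  rw [slope_def_field, centralMass_zero, sub_zero, sub_zero, sectionProfile]
  ring

theorem eventually_lt_sectionProfile {d : ℕ} (hd : 2 ≤ d) :
    ∀ᶠ b in 𝓝[>] (0 : ℝ), √((d : ℝ) + 1) * bspline d 0 < sectionProfile d b := by
  have hd1 : 1 ≤ d := by omega
  have hslope : ∀ᶠ b in 𝓝[>] (0 : ℝ), 0 < profileSlope d b := by
    have := eventually_lt_of_deriv_pos (f := profileSlope d)
      (f' := fun b => b * profileCurvature d b) (c := 0) (continuous_profileSlope hd1).continuousAt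
      (by
        filter_upwards [eventually_profileCurvature_pos hd, self_mem_nhdsWithin] with b hb hb0
        exact ⟨hasDerivAt_profileSlope_curvature hd b, mul_pos hb0 hb⟩)
    simpa [profileSlope_zero] using this
  have := eventually_lt_of_deriv_pos
    -- Division by zero gives `sectionProfile d 0 = 0`, so the value at `0` is replaced by the limit
    -- to restore continuity.
    (f := Function.update (sectionProfile d) 0 (√((d : ℝ) + 1) * bspline d 0))
    (f' := fun b => profileSlope d b / (b ^ 2 * √((d : ℝ) + 1 + b ^ 2))) (c := 0)
    (continuousAt_update_same.2 (tendsto_sectionProfile_zero hd1))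
    (by
      filter_upwards [hslope, self_mem_nhdsWithin] with b hb hb0
      have hb0' : (0 : ℝ) < b := hb0
      refine ⟨(hasDerivAt_sectionProfile hd1 hb0').congr_of_eventuallyEq ?_,
        div_pos hb (by positivity)⟩
      filter_upwards [Ioi_mem_nhds hb0'] with x hx
      rw [Function.update_of_ne (ne_of_gt hx)])
  filter_upwards [this, self_mem_nhdsWithin] with b hb hb0
  rwa [Function.update_self, Function.update_of_ne (ne_of_gt hb0)] at hb

/-! ### B-splines as densities, and volumes of slabs of the cube. -/

/-- The law of the sum of `d + 1` independent uniform random variables on `[-1/2, 1/2]`. -/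
noncomputable def splineMeasure (d : ℕ) : Measure ℝ :=
  volume.withDensity fun x => ENNReal.ofReal (bspline d x)

theorem splineMeasure_zero :
    splineMeasure 0 = volume.restrict (Icc (-(1 / 2) : ℝ) (1 / 2)) := by
  have h : (fun x => ENNReal.ofReal (bspline 0 x)) =
      (Ico (-(1 / 2) : ℝ) (1 / 2)).indicator 1 := by
    funext x
    rw [bspline_zero]
    simp only [indicator_apply]
    split_ifs <;> simp
  rw [splineMeasure, h, withDensity_indicator_one measurableSet_Ico]
  exact Measure.restrict_congr_set Ico_ae_eq_Icc

instance isProbabilityMeasure_splineMeasure_zero : IsProbabilityMeasure (splineMeasure 0) := by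
  constructor
  rw [splineMeasure_zero, Measure.restrict_apply_univ, Real.volume_Icc]
  norm_num

theorem splineMeasure_conv (d : ℕ) : splineMeasure d ∗ splineMeasure 0 = splineMeasure (d + 1) := by
  rw [splineMeasure, splineMeasure, conv_withDensity_eq_lconvolution
    (measurable_bspline d).ennreal_ofReal (measurable_bspline 0).ennreal_ofReal, splineMeasure]
  congr 1
  funext x
  -- As a function of `y`, `bspline 0 (x - y)` is the indicator of a reflected interval, hence open
  -- on the left and closed on the right.
  have h : ∀ y, ENNReal.ofReal (bspline d y) * ENNReal.ofReal (bspline 0 (-y + x)) =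
      (Ioc (x - 1 / 2) (x + 1 / 2)).indicator (fun y => ENNReal.ofReal (bspline d y)) y := by
    intro y
    simp only [bspline_zero, indicator_apply, mem_Ico, mem_Ioc]
    by_cases hy : x - 1 / 2 < y ∧ y ≤ x + 1 / 2
    · rw [if_pos hy, if_pos ⟨by linarith [hy.2], by linarith [hy.1]⟩]
      simp
    · rw [if_neg hy, if_neg (fun h => hy ⟨by linarith [h.2], by linarith [h.1]⟩)]
      simp
  rw [lconvolution_def, lintegral_congr h, lintegral_indicator measurableSet_Ioc, bspline_succ,
    intervalIntegral.integral_of_le (by linarith), ofReal_integral_eq_lintegral_ofReal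
    ((intervalIntegrable_iff_integrableOn_Ioc_of_le (by linarith)).1
      (intervalIntegrable_bspline d _ _)) (.of_forall fun y => bspline_nonneg d y)]

theorem splineMeasure_zero_map_sign {ε : ℝ} (hε : ε = 1 ∨ ε = -1) :
    (splineMeasure 0).map (fun t => ε * t) = splineMeasure 0 := by
  rcases hε with rfl | rfl
  · simp
  · have h := (Measure.measurePreserving_neg (volume : Measure ℝ)).restrict_preimage
      (measurableSet_Icc (a := (-(1 / 2) : ℝ)) (b := 1 / 2))
    rw [splineMeasure_zero]
    have h2 : (fun t : ℝ => -1 * t) = Neg.neg := by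
      funext t
      ring
    rw [h2]
    have h3 : Neg.neg ⁻¹' Icc (-(1 / 2) : ℝ) (1 / 2) = Icc (-(1 / 2)) (1 / 2) := by
      ext t
      simp only [mem_Icc, mem_preimage]
      constructor <;> rintro ⟨h1, h2⟩ <;> constructor <;> linarith
    rw [h3] at h
    rw [h.map_eq]

/-- The coordinates are independent and a uniform law on `[-1/2, 1/2]` is invariant under sign
change; splitting off one summand at a time gives a convolution with `splineMeasure 0`. -/
theorem splineMeasure_sum {ι : Type*} [Fintype ι] {ε : ι → ℝ} (hε : ∀ i, ε i = 1 ∨ ε i = -1)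
    {S : Finset ι} {d : ℕ} (hS : S.card = d + 1) :
    (Measure.pi fun _ : ι => splineMeasure 0).map (fun y => ∑ i ∈ S, ε i * y i) =
      splineMeasure d := by
  classical
  have hmeas : ∀ i, Measurable fun y : ι → ℝ => ε i * y i := fun i =>
    (measurable_pi_apply i).const_mul _
  have hlaw : ∀ i, (Measure.pi fun _ : ι => splineMeasure 0).map (fun y => ε i * y i) =
      splineMeasure 0 := by
    intro i
    have h := (measurePreserving_eval (fun _ : ι => splineMeasure 0) i).map_eq
    have h2 := Measure.map_map (μ := Measure.pi fun _ : ι => splineMeasure 0)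
      (measurable_const_mul (ε i)) (measurable_pi_apply i)
    rw [Function.comp_def] at h2
    rw [← h2]
    exact (congrArg _ h).trans (splineMeasure_zero_map_sign (hε i))
  have hind : iIndepFun (fun i (y : ι → ℝ) => ε i * y i)
      (Measure.pi fun _ : ι => splineMeasure 0) :=
    iIndepFun_pi (X := fun i (t : ℝ) => ε i * t) fun i => (measurable_const_mul _).aemeasurable
  induction d generalizing S with
  | zero =>
    obtain ⟨i, rfl⟩ := Finset.card_eq_one.1 hS
    simpa using hlaw i
  | succ d ih =>
    obtain ⟨i, hi⟩ : S.Nonempty := Finset.card_pos.1 (by omega)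
    have hcard : (S.erase i).card = d + 1 := by rw [Finset.card_erase_of_mem hi, hS]; rfl
    have h1 := hind.indepFun_finsetSum_of_notMem hmeas (Finset.notMem_erase i S)
    have h3 : (∑ j ∈ S.erase i, fun y : ι → ℝ => ε j * y j) =
        fun y => ∑ j ∈ S.erase i, ε j * y j := by
      funext y
      simp
    have hsum : Measurable (∑ j ∈ S.erase i, fun y : ι → ℝ => ε j * y j) := by
      rw [h3]
      exact Finset.measurable_sum _ fun j _ => hmeas j
    have h2 := h1.map_add_eq_map_conv_map hsum (hmeas i)
    have h4 : (fun y : ι → ℝ => ∑ j ∈ S, ε j * y j) =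
        (∑ j ∈ S.erase i, fun y : ι → ℝ => ε j * y j) + fun y => ε i * y i := by
      funext y
      rw [h3]
      exact (Finset.sum_erase_add S (fun j => ε j * y j) hi).symm
    rw [h4, h2, h3, ih hcard, hlaw, splineMeasure_conv]

theorem volume_slab {ι : Type*} [Fintype ι] {ε : ι → ℝ} (hε : ∀ i, ε i = 1 ∨ ε i = -1)
    {S : Finset ι} {d : ℕ} (hS : S.card = d + 1) {c : ℝ} (hc : 0 ≤ c) :
    volume {y : ι → ℝ | (∀ i, y i ∈ Icc (-(1 / 2) : ℝ) (1 / 2)) ∧ |∑ i ∈ S, ε i * y i| ≤ c} =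
      ENNReal.ofReal (∫ t in (-c)..c, bspline d t) := by
  have hm : Measurable fun y : ι → ℝ => ∑ i ∈ S, ε i * y i :=
    Finset.measurable_sum _ fun j _ => (measurable_pi_apply j).const_mul _
  have hset : {y : ι → ℝ | (∀ i, y i ∈ Icc (-(1 / 2) : ℝ) (1 / 2)) ∧ |∑ i ∈ S, ε i * y i| ≤ c} =
      (fun y => ∑ i ∈ S, ε i * y i) ⁻¹' Icc (-c) c ∩
        univ.pi fun _ => Icc (-(1 / 2) : ℝ) (1 / 2) := by
    ext y
    simp only [mem_ofPred_eq, mem_inter_iff, mem_preimage, mem_Icc, abs_le, Set.mem_pi, mem_univ,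
      forall_true_left]
    exact and_comm
  have hpi : volume.restrict (univ.pi fun _ : ι => Icc (-(1 / 2) : ℝ) (1 / 2)) =
      Measure.pi fun _ : ι => splineMeasure 0 := by
    rw [splineMeasure_zero, ← Measure.restrict_pi_pi, volume_pi]
  rw [hset, ← Measure.restrict_apply (hm measurableSet_Icc), hpi,
    ← Measure.map_apply hm measurableSet_Icc, splineMeasure_sum hε hS, splineMeasure,
    withDensity_apply _ measurableSet_Icc, intervalIntegral.integral_of_le (by linarith),
    ofReal_integral_eq_lintegral_ofReal
    ((intervalIntegrable_iff_integrableOn_Ioc_of_le (by linarith)).1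
      (intervalIntegrable_bspline d _ _)) (.of_forall fun y => bspline_nonneg d y)]
  exact setLIntegral_congr Ioc_ae_eq_Icc.symm

/-! ### Section volume as the volume of a slab in one dimension less. -/

theorem sq_det_of_gram {ι : Type*} [Fintype ι] [DecidableEq ι]
    (A : EuclideanSpace ℝ ι →ₗ[ℝ] EuclideanSpace ℝ ι) (G : Matrix ι ι ℝ)
    (h : ∀ a b, inner ℝ (A (EuclideanSpace.single a 1)) (A (EuclideanSpace.single b 1)) = G a b) :
    LinearMap.det A ^ 2 = G.det := by
  set B := (EuclideanSpace.basisFun ι ℝ).toBasis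
  set M := LinearMap.toMatrix B B A with hM
  have hG : M.transpose * M = G := by
    ext a b
    rw [← h a b, Matrix.mul_apply, PiLp.inner_apply]
    refine Finset.sum_congr rfl fun c _ => ?_
    simp [M, B, LinearMap.toMatrix_apply, mul_comm]
  rw [← hG, Matrix.det_mul, Matrix.det_transpose, hM, LinearMap.det_toMatrix, sq]

/-- A linear embedding with Gram matrix `G` scales the Euclidean Hausdorff measure
by `√(det G)`. -/
theorem euclideanHausdorffMeasure_image_of_gram {ι : Type*} [Fintype ι] [DecidableEq ι]
    {F : Type*} [NormedAddCommGroup F] [InnerProductSpace ℝ F] [MeasurableSpace F] [BorelSpace F]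
    (L : EuclideanSpace ℝ ι →ₗ[ℝ] F) (hL : Function.Injective L) (G : Matrix ι ι ℝ)
    (h : ∀ a b, inner ℝ (L (EuclideanSpace.single a 1)) (L (EuclideanSpace.single b 1)) = G a b)
    (s : Set (EuclideanSpace ℝ ι)) :
    μHE[Fintype.card ι] (L '' s) = ENNReal.ofReal √G.det * volume s := by
  have hfin : finrank ℝ (LinearMap.range L) = Fintype.card ι := by
    rw [LinearMap.finrank_range_of_inj hL, finrank_euclideanSpace]
  let φ : EuclideanSpace ℝ ι ≃ₗᵢ[ℝ] LinearMap.range L :=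
    ((stdOrthonormalBasis ℝ (LinearMap.range L)).reindex
      (Fintype.equivOfCardEq (by rw [Fintype.card_fin, hfin]))).repr.symm
  let A : EuclideanSpace ℝ ι →ₗ[ℝ] EuclideanSpace ℝ ι :=
    φ.symm.toLinearEquiv.toLinearMap ∘ₗ L.rangeRestrict
  have hLA : ∀ x, (φ (A x) : F) = L x := fun x => by simp [A]
  have hdet : LinearMap.det A ^ 2 = G.det := by
    refine sq_det_of_gram A G fun a b => ?_
    rw [← h a b, ← hLA, ← hLA, ← Submodule.coe_inner, φ.inner_map_map]
  have himage : L '' s = (fun x => (φ x : F)) '' (A '' s) := by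
    rw [image_image]
    exact image_congr fun x _ => (hLA x).symm
  have hiso : Isometry fun x => (φ x : F) := isometry_subtype_coe.comp φ.isometry
  have hvol : (μHE[Fintype.card ι] : Measure (EuclideanSpace ℝ ι)) = volume := by
    rw [← InnerProductSpace.euclideanHausdorffMeasure_eq_volume, finrank_euclideanSpace]
  rw [himage, hiso.euclideanHausdorffMeasure_image, hvol, Measure.addHaar_image_linearMap,
    ← hdet, Real.sqrt_sq_eq_abs]

/-- The hyperplane `u^⊥` as a graph over the coordinates different from `j`. -/
noncomputable def hyperplaneChart {n : ℕ} (u : EuclideanSpace ℝ (Fin n)) (j : Fin n) :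
    EuclideanSpace ℝ {i // i ≠ j} →ₗ[ℝ] EuclideanSpace ℝ (Fin n) where
  toFun y := WithLp.toLp 2 fun i =>
    if h : i = j then -(∑ l : {i // i ≠ j}, u l * y l) / u j else y ⟨i, h⟩
  map_add' x y := by
    ext i
    by_cases h : i = j
    · simp [h, mul_add, Finset.sum_add_distrib]
      ring
    · simp [h]
  map_smul' c y := by
    ext i
    by_cases h : i = j
    · simp only [h, PiLp.smul_apply, smul_eq_mul, dite_true, RingHom.id_apply]
      rw [show (∑ l : {i // i ≠ j}, u l * (c * y l)) = c * ∑ l : {i // i ≠ j}, u l * y l by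
        rw [Finset.mul_sum]; exact Finset.sum_congr rfl fun l _ => by ring]
      ring
    · simp [h]

theorem hyperplaneChart_self {n : ℕ} (u : EuclideanSpace ℝ (Fin n)) (j : Fin n)
    (y : EuclideanSpace ℝ {i // i ≠ j}) :
    hyperplaneChart u j y j = -(∑ l : {i // i ≠ j}, u l * y l) / u j := by
  simp [hyperplaneChart]

theorem hyperplaneChart_coe {n : ℕ} (u : EuclideanSpace ℝ (Fin n)) (j : Fin n)
    (y : EuclideanSpace ℝ {i // i ≠ j}) (l : {i // i ≠ j}) :
    hyperplaneChart u j y l = y l := by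
  simp [hyperplaneChart, l.2]

theorem hyperplaneChart_injective {n : ℕ} (u : EuclideanSpace ℝ (Fin n)) (j : Fin n) :
    Function.Injective (hyperplaneChart u j) := fun x y h => by
  ext l
  rw [← hyperplaneChart_coe u j x l, h, hyperplaneChart_coe]

theorem det_one_add_mul_self {ι : Type*} [Fintype ι] [DecidableEq ι] (w : ι → ℝ) :
    (Matrix.of fun a b => (if a = b then 1 else 0) + w a * w b).det = 1 + ∑ i, w i ^ 2 := by
  have h := Matrix.det_one_add_replicateCol_mul_replicateRow (ι := Unit) w w
  have e : (Matrix.of fun a b => (if a = b then (1 : ℝ) else 0) + w a * w b) =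
      1 + Matrix.replicateCol Unit w * Matrix.replicateRow Unit w := by
    ext a b
    simp [Matrix.mul_apply, Matrix.one_apply]
  rw [e, h]
  simp [dotProduct, sq]

theorem cube_inter_hyperplane {n : ℕ} {u : EuclideanSpace ℝ (Fin n)} {j : Fin n} (hj : u j ≠ 0) :
    cube n ∩ {x | inner ℝ u x = 0} = hyperplaneChart u j ''
      {y | (∀ l, y l ∈ Icc (-(1 / 2) : ℝ) (1 / 2)) ∧
        |∑ l : {i // i ≠ j}, u l * y l| ≤ |u j| / 2} := by
  have hinner : ∀ x : EuclideanSpace ℝ (Fin n),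
      inner ℝ u x = u j * x j + ∑ l : {i // i ≠ j}, u l * x l := fun x => by
    rw [PiLp.inner_apply, Fintype.sum_eq_add_sum_subtype_ne _ j]
    simp [mul_comm]
  have hj' : 0 < |u j| := abs_pos.2 hj
  have hmem : ∀ t : ℝ, -t / u j ∈ Icc (-(1 / 2) : ℝ) (1 / 2) ↔ |t| ≤ |u j| / 2 := fun t => by
    rw [mem_Icc, ← abs_le, abs_div, abs_neg, div_le_iff₀ hj']
    constructor <;> intro h <;> linarith
  ext x
  constructor
  · rintro ⟨hx, hxu⟩
    have hxu' : inner ℝ u x = 0 := hxu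
    rw [hinner] at hxu'
    have hxj : x j = -(∑ l : {i // i ≠ j}, u l * x l) / u j := by
      rw [eq_div_iff hj]
      linarith
    refine ⟨WithLp.toLp 2 fun l => x l, ⟨fun l => hx l, ?_⟩, ?_⟩
    · rw [← hmem]
      have := hx j
      rwa [hxj] at this
    · ext i
      by_cases h : i = j
      · subst h
        rw [hyperplaneChart_self, hxj]
      · exact hyperplaneChart_coe u j _ ⟨i, h⟩
  · rintro ⟨y, ⟨hy, hyu⟩, rfl⟩
    refine ⟨fun i => ?_, ?_⟩
    · by_cases h : i = j
      · subst h
        rw [hyperplaneChart_self, hmem]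
        exact hyu
      · have := hyperplaneChart_coe u j y ⟨i, h⟩
        simp only at this
        rw [this]
        exact hy _
    · change inner ℝ u (hyperplaneChart u j y) = 0
      simp only [hinner, hyperplaneChart_self, hyperplaneChart_coe]
      field_simp
      ring

/-- The chart over the coordinates other than `j` has Gram matrix `1 + w wᵀ` with `w = u / u j`. Its
determinant is `1 + |w|² = 1 / (u j)²`, because `u` is a unit vector. -/
theorem centralSectionVolume_eq_slab {n : ℕ} {u : EuclideanSpace ℝ (Fin n)} (hu : ‖u‖ = 1)
    {j : Fin n} (hj : u j ≠ 0) :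
    centralSectionVolume u = ENNReal.ofReal (1 / |u j|) *
      volume {y : {i // i ≠ j} → ℝ | (∀ l, y l ∈ Icc (-(1 / 2) : ℝ) (1 / 2)) ∧
        |∑ l : {i // i ≠ j}, u l * y l| ≤ |u j| / 2} := by
  set w : {i // i ≠ j} → ℝ := fun l => u l / u j with hw
  have hcard : Fintype.card {i // i ≠ j} = n - 1 := by simp
  have hgram : ∀ a b, inner ℝ (hyperplaneChart u j (EuclideanSpace.single a 1))
      (hyperplaneChart u j (EuclideanSpace.single b 1)) =
      (Matrix.of fun a b => (if a = b then 1 else 0) + w a * w b) a b := by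
    intro a b
    rw [PiLp.inner_apply, Fintype.sum_eq_add_sum_subtype_ne _ j]
    simp only [hyperplaneChart_self, hyperplaneChart_coe, Matrix.of_apply]
    simp [hw]
    ring
  have hsum : 1 + ∑ l, w l ^ 2 = (1 / |u j|) ^ 2 := by
    have h1 : u j ^ 2 + ∑ l : {i // i ≠ j}, u l ^ 2 = 1 := by
      have := EuclideanSpace.real_norm_sq_eq u
      rw [hu, Fintype.sum_eq_add_sum_subtype_ne _ j] at this
      linarith
    simp only [hw, div_pow, one_pow, sq_abs]
    rw [← Finset.sum_div]
    field_simp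
    exact h1
  have h := euclideanHausdorffMeasure_image_of_gram (hyperplaneChart u j)
    (hyperplaneChart_injective u j) _ hgram
    {y | (∀ l, y l ∈ Icc (-(1 / 2) : ℝ) (1 / 2)) ∧
      |∑ l : {i // i ≠ j}, u l * y l| ≤ |u j| / 2}
  rw [centralSectionVolume, cube_inter_hyperplane hj, ← hcard, h, det_one_add_mul_self, hsum,
    Real.sqrt_sq (by positivity)]
  congr 1
  exact (EuclideanSpace.volume_preserving_symm_measurableEquiv_toLp _).measure_preimage_equiv
    {y : {i // i ≠ j} → ℝ | (∀ l, y l ∈ Icc (-(1 / 2) : ℝ) (1 / 2)) ∧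
      |∑ l : {i // i ≠ j}, u l * y l| ≤ |u j| / 2}

/-! ### The curves of tilted diagonals. -/

/-- The unit vector proportional to the vector with coordinates `ε i` on `S`, `b * ε j` at `j`, and
zero elsewhere, for signs `ε`. -/
noncomputable def tiltedDiagonal {n : ℕ} (S : Finset (Fin n)) (j : Fin n) (ε : Fin n → ℝ) (b : ℝ) :
    EuclideanSpace ℝ (Fin n) :=
  WithLp.toLp 2 fun i => (√((S.card : ℝ) + b ^ 2))⁻¹ *
    if i = j then b * ε j else if i ∈ S then ε i else 0

section

variable {n : ℕ} {S : Finset (Fin n)} {j : Fin n} {ε : Fin n → ℝ}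

theorem tiltedDiagonal_self (b : ℝ) :
    tiltedDiagonal S j ε b j = (√((S.card : ℝ) + b ^ 2))⁻¹ * (b * ε j) := by
  simp [tiltedDiagonal]

theorem tiltedDiagonal_of_mem {b : ℝ} {i : Fin n} (hj : j ∉ S) (hi : i ∈ S) :
    tiltedDiagonal S j ε b i = (√((S.card : ℝ) + b ^ 2))⁻¹ * ε i := by
  have : i ≠ j := fun h => hj (h ▸ hi)
  simp [tiltedDiagonal, this, hi]

theorem tiltedDiagonal_of_notMem {b : ℝ} {i : Fin n} (hij : i ≠ j) (hi : i ∉ S) :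
    tiltedDiagonal S j ε b i = 0 := by
  simp [tiltedDiagonal, hij, hi]

theorem norm_tiltedDiagonal (hj : j ∉ S) (hS : S.Nonempty) (hε : ∀ i, ε i = 1 ∨ ε i = -1) (b : ℝ) :
    ‖tiltedDiagonal S j ε b‖ = 1 := by
  have hε2 : ∀ i, ε i ^ 2 = 1 := fun i => by rcases hε i with h | h <;> rw [h] <;> norm_num
  have hc : (0 : ℝ) < S.card := by exact_mod_cast hS.card_pos
  have hpos : 0 < (S.card : ℝ) + b ^ 2 := by positivity
  have h := EuclideanSpace.real_norm_sq_eq (tiltedDiagonal S j ε b)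
  have hsum : ∑ i, tiltedDiagonal S j ε b i ^ 2 = 1 := by
    rw [← Finset.sum_subset (Finset.subset_univ (insert j S)) fun i _ hi => by
      rw [Finset.mem_insert, not_or] at hi
      rw [tiltedDiagonal_of_notMem hi.1 hi.2]
      norm_num, Finset.sum_insert hj,
      Finset.sum_congr rfl fun i hi => by rw [tiltedDiagonal_of_mem hj hi, mul_pow, hε2, mul_one],
      tiltedDiagonal_self, Finset.sum_const, nsmul_eq_mul, mul_pow, mul_pow, hε2, inv_pow,
      Real.sq_sqrt hpos.le]
    field_simp
    ring
  rw [hsum] at h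
  exact (pow_eq_one_iff_of_nonneg (norm_nonneg _) two_ne_zero).1 h

theorem continuous_tiltedDiagonal (hS : S.Nonempty) :
    Continuous fun b => tiltedDiagonal S j ε b := by
  have hc : (0 : ℝ) < S.card := by exact_mod_cast hS.card_pos
  refine (PiLp.continuous_toLp 2 _).comp (continuous_pi fun i => ?_)
  refine Continuous.mul (Continuous.inv₀ (by fun_prop) fun b => ?_) ?_
  · exact (Real.sqrt_pos.2 (by positivity)).ne'
  · split_ifs <;> fun_prop

theorem centralSectionVolume_tiltedDiagonal (hj : j ∉ S) {d : ℕ} (hS : S.card = d + 1)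
    (hε : ∀ i, ε i = 1 ∨ ε i = -1) {b : ℝ} (hb : 0 < b) :
    centralSectionVolume (tiltedDiagonal S j ε b) = ENNReal.ofReal (sectionProfile d b) := by
  have hne : S.Nonempty := Finset.card_pos.1 (by omega)
  have hpos : 0 < (S.card : ℝ) + b ^ 2 := by positivity
  have hs : 0 < √((S.card : ℝ) + b ^ 2) := Real.sqrt_pos.2 hpos
  have habs : |tiltedDiagonal S j ε b j| = b / √((S.card : ℝ) + b ^ 2) := by
    have : |ε j| = 1 := by rcases hε j with h | h <;> rw [h] <;> norm_num
    rw [tiltedDiagonal_self, abs_mul, abs_mul, this, abs_of_pos hb, abs_of_pos (inv_pos.2 hs)]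
    field_simp
  have hj0 : tiltedDiagonal S j ε b j ≠ 0 := by
    rw [← abs_pos, habs]
    positivity
  set T : Finset {i // i ≠ j} := S.subtype (· ≠ j) with hT
  have hTcard : T.card = d + 1 := by
    rw [hT, Finset.card_subtype,
      Finset.filter_true_of_mem (fun i hi => ne_of_mem_of_not_mem hi hj), hS]
  have hsum : ∀ y : {i // i ≠ j} → ℝ, ∑ l : {i // i ≠ j}, tiltedDiagonal S j ε b l * y l =
      (√((S.card : ℝ) + b ^ 2))⁻¹ * ∑ l ∈ T, ε l * y l := by
    intro y
    rw [Finset.mul_sum, ← Finset.sum_subset (Finset.subset_univ T) fun l _ hl => by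
      rw [tiltedDiagonal_of_notMem l.2 fun h => hl (by rw [hT, Finset.mem_subtype]; exact h),
        zero_mul]]
    refine Finset.sum_congr rfl fun l hl => ?_
    rw [tiltedDiagonal_of_mem hj (Finset.mem_subtype.1 hl), mul_assoc]
  have hset : {y : {i // i ≠ j} → ℝ | (∀ l, y l ∈ Icc (-(1 / 2) : ℝ) (1 / 2)) ∧
        |∑ l : {i // i ≠ j}, tiltedDiagonal S j ε b l * y l| ≤ |tiltedDiagonal S j ε b j| / 2} =
      {y | (∀ l, y l ∈ Icc (-(1 / 2) : ℝ) (1 / 2)) ∧ |∑ l ∈ T, ε l * y l| ≤ b / 2} := by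
    ext y
    simp only [mem_ofPred_eq]
    rw [hsum, habs, abs_mul, abs_of_pos (inv_pos.2 hs), inv_mul_le_iff₀ hs]
    refine and_congr_right fun _ => ?_
    rw [show √((S.card : ℝ) + b ^ 2) * (b / √((S.card : ℝ) + b ^ 2) / 2) = b / 2 by field_simp]
  rw [centralSectionVolume_eq_slab (norm_tiltedDiagonal hj hne hε b) hj0, hset,
    volume_slab (ε := fun l : {i // i ≠ j} => ε l) (fun l => hε l) hTcard (by positivity),
    ← ENNReal.ofReal_mul (by positivity), habs, one_div_div, sectionProfile, centralMass, hS]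
  push_cast
  rfl

theorem tendsto_tiltedDiagonal (hj : j ∉ S) (hS : S.Nonempty) (hε : ∀ i, ε i = 1 ∨ ε i = -1)
    (b : ℝ) : Tendsto (tiltedDiagonal S j ε) (𝓝[>] b)
      (𝓝[Metric.sphere 0 1] (tiltedDiagonal S j ε b)) :=
  tendsto_nhdsWithin_iff.2 ⟨((continuous_tiltedDiagonal hS).tendsto b).mono_left nhdsWithin_le_nhds,
    .of_forall fun c => by
      rw [mem_sphere_zero_iff_norm]
      exact norm_tiltedDiagonal hj hS hε c⟩

theorem not_isLocalMinOn_tiltedDiagonal_one (hj : j ∉ S) (hS : 2 ≤ S.card)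
    (hε : ∀ i, ε i = 1 ∨ ε i = -1) :
    ¬ IsLocalMinOn centralSectionVolume (Metric.sphere 0 1) (tiltedDiagonal S j ε 1) := by
  intro hmin
  obtain ⟨d, hd⟩ := Nat.exists_eq_add_of_le' (show 1 ≤ S.card by omega)
  have hne : S.Nonempty := Finset.card_pos.1 (by omega)
  obtain ⟨b, h1, h2, hb⟩ := ((tendsto_tiltedDiagonal hj hne hε 1 |>.eventually hmin).and
    ((eventually_sectionProfile_lt (show 1 ≤ d by omega)).and self_mem_nhdsWithin)).exists
  have hb0 : (0 : ℝ) < b := zero_lt_one.trans hb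
  rw [centralSectionVolume_tiltedDiagonal hj hd hε one_pos,
    centralSectionVolume_tiltedDiagonal hj hd hε hb0] at h1
  refine absurd h1 (not_le.2 ((ENNReal.ofReal_lt_ofReal_iff ?_).2 h2))
  rw [sectionProfile_one]
  have := bspline_pos (d := d + 1) (by omega) le_rfl (by positivity)
  positivity

/-- At `b = 0` the coordinate `j` vanishes and the graph chart over it breaks down, so the volume
there is a hypothesis, to be supplied from a chart at a nonzero coordinate. It equals the limit of
the profile as `b` tends to `0`. -/
theorem not_isLocalMaxOn_tiltedDiagonal_zero (hj : j ∉ S) (hS : 3 ≤ S.card)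
    (hε : ∀ i, ε i = 1 ∨ ε i = -1)
    (hval : centralSectionVolume (tiltedDiagonal S j ε 0) =
      ENNReal.ofReal (√(S.card : ℝ) * bspline (S.card - 1) 0)) :
    ¬ IsLocalMaxOn centralSectionVolume (Metric.sphere 0 1) (tiltedDiagonal S j ε 0) := by
  intro hmax
  obtain ⟨d, hd⟩ := Nat.exists_eq_add_of_le' (show 1 ≤ S.card by omega)
  have hne : S.Nonempty := Finset.card_pos.1 (by omega)
  obtain ⟨b, h1, h2, hb⟩ := ((tendsto_tiltedDiagonal hj hne hε 0 |>.eventually hmax).and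
    ((eventually_lt_sectionProfile (show 2 ≤ d by omega)).and self_mem_nhdsWithin)).exists
  rw [hval, centralSectionVolume_tiltedDiagonal hj hd hε hb, hd, Nat.add_sub_cancel] at h1
  push_cast at h1
  refine absurd h1 (not_le.2 ((ENNReal.ofReal_lt_ofReal_iff ?_).2 h2))
  refine lt_of_le_of_lt ?_ h2
  exact mul_nonneg (Real.sqrt_nonneg _) (bspline_nonneg _ _)

end

/-! ### Coordinates of `k`-diagonals and the conclusion. -/

theorem IsDiagonalDirection.exists_signs {n k : ℕ} {u : EuclideanSpace ℝ (Fin n)}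
    (hu : IsDiagonalDirection k u) :
    ∃ (T : Finset (Fin n)) (ε : Fin n → ℝ), T.card = k ∧ (∀ i, ε i = 1 ∨ ε i = -1) ∧
      (∀ i ∈ T, u i = (√(k : ℝ))⁻¹ * ε i) ∧ ∀ i ∉ T, u i = 0 := by
  classical
  obtain ⟨hnorm, p, hp, q, hq, hk, c, rfl⟩ := hu
  set T := Finset.univ.filter fun i => p i ≠ q i with hT
  have hin : ∀ i ∈ T, q i - p i = 1 ∨ q i - p i = -1 := by
    intro i hi
    have hne : p i ≠ q i := (Finset.mem_filter.1 hi).2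
    rcases hp i with h1 | h1 <;> rcases hq i with h2 | h2 <;> rw [h1, h2] at hne ⊢ <;>
      first | exact absurd rfl hne | norm_num
  have hout : ∀ i ∉ T, q i - p i = 0 := by
    intro i hi
    have : p i = q i := by
      by_contra h
      exact hi (Finset.mem_filter.2 ⟨Finset.mem_univ i, h⟩)
    rw [this, sub_self]
  have hcoord : ∀ i, (c • (q - p)) i = c * (q i - p i) := fun i => rfl
  have hc : c ^ 2 * k = 1 := by
    have h := EuclideanSpace.real_norm_sq_eq (c • (q - p))
    rw [hnorm, ← Finset.sum_subset (Finset.subset_univ T) fun i _ hi => by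
      rw [hcoord, hout i hi]
      norm_num, Finset.sum_congr rfl fun i hi => show (c • (q - p)) i ^ 2 = c ^ 2 by
        rw [hcoord]
        rcases hin i hi with h | h <;> rw [h] <;> ring, Finset.sum_const, hk] at h
    rw [nsmul_eq_mul] at h
    linarith
  have hk0 : (0 : ℝ) < k := by
    rcases Nat.eq_zero_or_pos k with rfl | h
    · norm_num at hc
    · exact_mod_cast h
  have hs : 0 < √(k : ℝ) := Real.sqrt_pos.2 hk0
  have hs2 : √(k : ℝ) ^ 2 = k := Real.sq_sqrt hk0.le
  have hcs : c * √(k : ℝ) = 1 ∨ c * √(k : ℝ) = -1 := by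
    rw [← sq_eq_one_iff, mul_pow, hs2, hc]
  -- Normalisation forces `c √k = ±1`, so the product with `q i - p i = ±1` is a sign; off `T` any
  -- sign would do.
  refine ⟨T, fun i => if i ∈ T then c * √(k : ℝ) * (q i - p i) else 1, hk, fun i => ?_,
    fun i hi => ?_, fun i hi => ?_⟩
  · by_cases hi : i ∈ T
    · simp only [if_pos hi]
      rcases hcs with h1 | h1 <;> rcases hin i hi with h2 | h2 <;> rw [h1, h2] <;> norm_num
    · exact Or.inl (if_neg hi)
  · simp only [if_pos hi]
    rw [hcoord]
    field_simp
  · rw [hcoord, hout i hi, mul_zero]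

end CubeSection

theorem theorem1p4 (n k : ℕ) (hn : 4 ≤ n) (hk : 3 ≤ k) (hkn : k ≤ n - 1)
    (u : EuclideanSpace ℝ (Fin n)) (hu : CubeSection.IsDiagonalDirection k u) :
    ¬ IsLocalExtrOn CubeSection.centralSectionVolume
      (Metric.sphere (0 : EuclideanSpace ℝ (Fin n)) 1) u := by
  open CubeSection in
  obtain ⟨T, ε, hT, hε, hin, hout⟩ := hu.exists_signs
  obtain ⟨i, hi⟩ : T.Nonempty := Finset.card_pos.1 (by omega)
  obtain ⟨j, hj⟩ : ∃ j, j ∉ T := by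
    by_contra! h
    have := Finset.card_eq_of_equiv_fin (Equiv.subtypeUnivEquiv h)
    omega
  have hcard : (T.erase i).card = k - 1 := by rw [Finset.card_erase_of_mem hi, hT]
  have hu1 : u = tiltedDiagonal (T.erase i) i ε 1 := by
    have hsq : ((T.erase i).card : ℝ) + 1 ^ 2 = k := by
      rw [hcard, Nat.cast_sub (by omega)]
      norm_num
    ext l
    by_cases hl : l ∈ T
    · by_cases hli : l = i
      · rw [hli, tiltedDiagonal_self, hsq, one_mul, hin i hi]
      · rw [tiltedDiagonal_of_mem (Finset.notMem_erase i T) (Finset.mem_erase.2 ⟨hli, hl⟩), hsq,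
          hin l hl]
    · rw [tiltedDiagonal_of_notMem (fun h => hl (by rwa [h])) (fun h => hl (Finset.mem_of_mem_erase h)),
        hout l hl]
  have hu0 : u = tiltedDiagonal T j ε 0 := by
    have hsq : (T.card : ℝ) + 0 ^ 2 = k := by
      rw [hT]
      norm_num
    ext l
    by_cases hl : l ∈ T
    · rw [tiltedDiagonal_of_mem hj hl, hsq, hin l hl]
    · rw [hout l hl]
      by_cases hlj : l = j
      · rw [hlj, tiltedDiagonal_self, zero_mul, mul_zero]
      · rw [tiltedDiagonal_of_notMem hlj hl]
  rintro (hmin | hmax)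
  · rw [hu1] at hmin
    exact not_isLocalMinOn_tiltedDiagonal_one (Finset.notMem_erase i T) (by omega) hε hmin
  · rw [hu0] at hmax
    refine not_isLocalMaxOn_tiltedDiagonal_zero hj (by omega) hε ?_ hmax
    -- The missing value at `b = 0` is computed on the other curve, at `b = 1` with `k - 1` fixed
    -- signs: it is `√k * bspline (k - 1) 0`.
    rw [← hu0, hu1, centralSectionVolume_tiltedDiagonal (d := k - 2) (Finset.notMem_erase i T)
      (by omega) hε one_pos, sectionProfile_one, hT, Nat.cast_sub (by omega),
      show k - 2 + 1 = k - 1 by omega]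
    norm_num
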